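/- Let $\mathbb{D}$ be the open unit disk. Equip the unit circle $\partial\mathbb{D}$ with normalized Lebesgue measure, let $L^2=L^2(\partial\mathbb{D})$ with $\langle f,g\rangle=\frac1{2\pi}\int_0^{2\pi}f(e^{it})\overline{g(e^{it})}\,dt$, and let $H^2\subset L^2$ be the Hardy space, identified via boundary values with the closed subspace of all $f\in L^2$ whose Fourier coefficients of negative index vanish. An inner function is a bounded analytic function $\alpha$ on $\mathbb{D}$ whose radial limits have modulus $1$ almost everywhere on $\partial\mathbb{D}$. Its model space is $K_\alpha=H^2\ominus\alpha H^2$, and $P_\alpha$ denotes the orthogonal projection of $L^2$ onto $K_\alpha$. For $w\in\overline{\mathbb{D}}$ put $$k_w^\alpha(z)=\frac{1-\overline{\alpha(w)}\,\alpha(z)}{1-\overline{w}z},\qquad \widetilde{k}_w^\alpha=C_\alpha k_w^\alpha,\quad\text{that is,}\quad \widetilde{k}_w^\alpha(z)=\frac{\alpha(z)-\alpha(w)}{z-w},$$ where $C_\alpha f(z)=\alpha(z)\overline{z}\,\overline{f(z)}$ for $|z|=1$, and where for $|w|=1$ the value $\alpha(w)$ is the radial limit $\lim_{r\to1^-}\alpha(rw)$.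 For inner functions $\alpha,\beta$ let $\mathcal{T}(\alpha,\beta)$ be the space of all bounded operators $A\colon K_\alpha\to K_\beta$ for which there is $\varphi\in L^2$ such that $Af=P_\beta(\varphi f)$ for all bounded $f\in K_\alpha$ (the bounded asymmetric truncated Toeplitz operators). For $g\in K_\beta$ and $h\in K_\alpha$ let $g\otimes h\colon K_\alpha\to K_\beta$ be the operator $f\mapsto\langle f,h\rangle g$. Let $\alpha$ and $\beta$ be inner functions such that $K_\alpha$ has finite dimension $m>0$ and $K_\beta$ has finite dimension $n>0$, and let $w_1,\dots,w_{m+n-1}$ be distinct points of the closed unit disk $\overline{\mathbb{D}}$. Then the functions $k_{w_j}^\alpha,\widetilde{k}_{w_j}^\alpha$ belong to $K_\alpha$, the functions $k_{w_j}^\beta,\widetilde{k}_{w_j}^\beta$ belong to $K_\beta$, and: (a) the operators $\widetilde{k}_{w_j}^{\beta}\otimes k_{w_j}^{\alpha}$, $j=1,\dots,m+n-1$, form a basis of $\mathcal{T}(\alpha,\beta)$; (b) the operators $k_{w_j}^{\beta}\otimes\widetilde{k}_{w_j}^{\alpha}$, $j=1,\dots,m+n-1$, form a basis of $\mathcal{T}(\alpha,\beta)$.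 -/

import Mathlib

open MeasureTheory Filter Topology AddCircle

noncomputable section

namespace ATTO

instance factTwoPiPos : Fact ((0 : ℝ) < 2 * Real.pi) := ⟨Real.two_pi_pos⟩

/-- The unit circle `∂𝔻`, parametrized by the angle `t ∈ ℝ / 2πℤ`. -/
abbrev Torus : Type := AddCircle (2 * Real.pi)

/-- Normalized Lebesgue measure `dt / 2π` on the circle. -/
abbrev arc : Measure Torus := haarAddCircle

/-- The point `e^{it}` of the circle, as a complex number. -/
def pt (t : Torus) : ℂ := (toCircle t : ℂ)

/-- The Hilbert space `L²(∂𝔻)`, with inner product `⟨f, g⟩ = (1/2π) ∫ f ḡ dt`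
(Mathlib's `inner ℂ g f`). -/
abbrev L2 : Type := Lp ℂ 2 arc

/-- The value of `α` at a point of the closed unit disk: `α w` in the open disk, and the radial
limit `lim_{r → 1⁻} α (r w)` at a point `w` of the unit circle. -/
def value (α : ℂ → ℂ) (w : ℂ) : ℂ :=
  if ‖w‖ < 1 then α w else limUnder (𝓝[<] (1 : ℝ)) fun r : ℝ => α ((r : ℂ) * w)

/-- The boundary function `t ↦ α(e^{it})` of a function on the disk. -/
def bdry (α : ℂ → ℂ) (t : Torus) : ℂ := value α (pt t)

/-- `α` is an inner function: bounded and analytic in the open unit disk, with radial limits of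
modulus one at almost every point of the circle. Values outside the open disk are irrelevant. -/
structure IsInner (α : ℂ → ℂ) : Prop where
  analytic : DifferentiableOn ℂ α (Metric.ball 0 1)
  bounded : ∃ C : ℝ, ∀ z ∈ Metric.ball (0 : ℂ) 1, ‖α z‖ ≤ C
  unimodular : ∀ᵐ t ∂arc, ∃ ζ : ℂ, ‖ζ‖ = 1 ∧
    Tendsto (fun r : ℝ => α ((r : ℂ) * pt t)) (𝓝[<] (1 : ℝ)) (𝓝 ζ)

/-- The Hardy space `H²`, identified via boundary values with the subspace of those `f ∈ L²(∂𝔻)`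
whose Fourier coefficients of negative index vanish. -/
def hardy : Submodule ℂ L2 where
  carrier := {f | ∀ n : ℤ, n < 0 → fourierCoeff (f : Torus → ℂ) n = 0}
  zero_mem' := by
    intro n _
    rw [← fourierBasis_repr]; simp
  add_mem' := by
    intro f g hf hg n hn
    rw [← fourierBasis_repr, map_add, lp.coeFn_add, Pi.add_apply, fourierBasis_repr,
      fourierBasis_repr, hf n hn, hg n hn, add_zero]
  smul_mem' := by
    intro c f hf n hn
    rw [← fourierBasis_repr, map_smul, lp.coeFn_smul, Pi.smul_apply, fourierBasis_repr,
      hf n hn, smul_zero]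

/-- The subspace `α H² = {α f : f ∈ H²}` of `L²(∂𝔻)`. -/
def mulHardy (α : ℂ → ℂ) : Submodule ℂ L2 where
  carrier := {g | ∃ f ∈ hardy, g =ᵐ[arc] fun t => bdry α t * f t}
  zero_mem' := by
    refine ⟨0, hardy.zero_mem, ?_⟩
    filter_upwards [Lp.coeFn_zero ℂ 2 arc] with t ht
    rw [ht]; simp
  add_mem' := by
    rintro g₁ g₂ ⟨f₁, hf₁, h₁⟩ ⟨f₂, hf₂, h₂⟩
    refine ⟨f₁ + f₂, hardy.add_mem hf₁ hf₂, ?_⟩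
    filter_upwards [h₁, h₂, Lp.coeFn_add g₁ g₂, Lp.coeFn_add f₁ f₂] with t a b c d
    rw [c, d, Pi.add_apply, Pi.add_apply, a, b, mul_add]
  smul_mem' := by
    rintro c g ⟨f, hf, h⟩
    refine ⟨c • f, hardy.smul_mem c hf, ?_⟩
    filter_upwards [h, Lp.coeFn_smul c g, Lp.coeFn_smul c f] with t a b d
    rw [b, d, Pi.smul_apply, Pi.smul_apply, a, smul_eq_mul, smul_eq_mul]; ring

/-- The model space `K_α = H² ⊖ α H²`. -/
def modelSpace (α : ℂ → ℂ) : Submodule ℂ L2 := hardy ⊓ (mulHardy α)ᗮ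

theorem isClosed_hardy : IsClosed (hardy : Set L2) := by
  have h : (hardy : Set L2) =
      ⋂ n : ℤ, ⋂ _ : n < 0, {f : L2 | inner ℂ (fourierBasis (T := 2 * Real.pi) n) f = 0} := by
    ext f
    simp only [Set.mem_iInter, Set.mem_ofPred_eq, ← HilbertBasis.repr_apply_apply,
      fourierBasis_repr]
    rfl
  rw [h]
  exact isClosed_iInter fun n => isClosed_iInter fun _ =>
    isClosed_eq (continuous_const.inner continuous_id) continuous_const

theorem isClosed_modelSpace (α : ℂ → ℂ) : IsClosed (modelSpace α : Set L2) :=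
  isClosed_hardy.inter (Submodule.isClosed_orthogonal _)

instance completeSpaceModelSpace (α : ℂ → ℂ) : CompleteSpace (modelSpace α) :=
  (isClosed_modelSpace α).completeSpace_coe

/-- The orthogonal projection `P_α` of `L²(∂𝔻)` onto `K_α`. -/
def proj (α : ℂ → ℂ) : L2 →L[ℂ] modelSpace α := (modelSpace α).orthogonalProjectionOnto

/-- The bounded operator `A : K_α → K_β` is the asymmetric truncated Toeplitz operator with symbol
`φ`: on the bounded functions `f ∈ K_α` (a dense subspace of `K_α`, which is all of `K_α` if the
dimension is finite), the product `φ f` is in `L²(∂𝔻)` and `A f = P_β (φ f)`. -/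
def IsToeplitzWithSymbol {α β : ℂ → ℂ} (φ : L2) (A : modelSpace α →L[ℂ] modelSpace β) : Prop :=
  ∀ f : modelSpace α, MemLp ((f : L2) : Torus → ℂ) ⊤ arc →
    ∃ h : MemLp (fun t => φ t * (f : L2) t) 2 arc, A f = proj β (h.toLp _)

/-- The space `𝒯(α, β)` of all bounded asymmetric truncated Toeplitz operators from `K_α` to `K_β`
with symbols in `L²(∂𝔻)`. -/
def toeplitz (α β : ℂ → ℂ) : Submodule ℂ (modelSpace α →L[ℂ] modelSpace β) where
  carrier := {A | ∃ φ : L2, IsToeplitzWithSymbol φ A}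
  zero_mem' := by
    refine ⟨0, fun f hf => ?_⟩
    have e : (fun t => (0 : L2) t * (f : L2) t) =ᵐ[arc] 0 := by
      filter_upwards [Lp.coeFn_zero ℂ 2 arc] with t ht
      rw [ht]; simp
    have h : MemLp (fun t => (0 : L2) t * (f : L2) t) 2 arc := (memLp_congr_ae e).2 MemLp.zero
    refine ⟨h, ?_⟩
    have : h.toLp _ = 0 := (MemLp.toLp_eq_toLp_iff h MemLp.zero).2 e
    rw [this]; simp
  add_mem' := by
    rintro A B ⟨φ, hφ⟩ ⟨ψ, hψ⟩
    refine ⟨φ + ψ, fun f hf => ?_⟩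
    obtain ⟨h₁, e₁⟩ := hφ f hf
    obtain ⟨h₂, e₂⟩ := hψ f hf
    have e : (fun t => (φ + ψ : L2) t * (f : L2) t) =ᵐ[arc]
        (fun t => φ t * (f : L2) t) + fun t => ψ t * (f : L2) t := by
      filter_upwards [Lp.coeFn_add φ ψ] with t ht
      rw [ht]; simp [add_mul]
    have h : MemLp (fun t => (φ + ψ : L2) t * (f : L2) t) 2 arc :=
      (memLp_congr_ae e).2 (h₁.add h₂)
    refine ⟨h, ?_⟩
    have : h.toLp _ = h₁.toLp _ + h₂.toLp _ := by
      rw [← MemLp.toLp_add]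
      exact (MemLp.toLp_eq_toLp_iff h (h₁.add h₂)).2 e
    rw [this, map_add, ← e₁, ← e₂]; rfl
  smul_mem' := by
    rintro c A ⟨φ, hφ⟩
    refine ⟨c • φ, fun f hf => ?_⟩
    obtain ⟨h₁, e₁⟩ := hφ f hf
    have e : (fun t => (c • φ : L2) t * (f : L2) t) =ᵐ[arc] c • fun t => φ t * (f : L2) t := by
      filter_upwards [Lp.coeFn_smul c φ] with t ht
      rw [ht]; simp [mul_assoc]
    have h : MemLp (fun t => (c • φ : L2) t * (f : L2) t) 2 arc :=
      (memLp_congr_ae e).2 (h₁.const_smul c)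
    refine ⟨h, ?_⟩
    have : h.toLp _ = c • h₁.toLp _ := by
      rw [← MemLp.toLp_const_smul]
      exact (MemLp.toLp_eq_toLp_iff h (h₁.const_smul c)).2 e
    rw [this, map_smul, ← e₁]; rfl

/-- The boundary function of the reproducing kernel
`k_w^α(z) = (1 - conj (α(w)) α(z)) / (1 - conj w · z)`, for `w` in the closed disk. -/
def kernelFun (α : ℂ → ℂ) (w : ℂ) (t : Torus) : ℂ :=
  (1 - star (value α w) * bdry α t) / (1 - star w * pt t)

/-- The conjugation `C_α f (z) = α(z) · conj z · conj (f z)` on functions on the circle. -/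
def conjugation (α : ℂ → ℂ) (f : Torus → ℂ) (t : Torus) : ℂ :=
  bdry α t * star (pt t) * star (f t)

open Classical in
/-- The element of `K_α` represented by a function on the circle. The value is `0` if the function
does not represent an element of `K_α`. -/
def toModel (α : ℂ → ℂ) (u : Torus → ℂ) : modelSpace α :=
  if h : ∃ f : modelSpace α, ((f : L2) : Torus → ℂ) =ᵐ[arc] u then h.choose else 0

/-- The reproducing kernel `k_w^α` as an element of `K_α`. -/
def kernel (α : ℂ → ℂ) (w : ℂ) : modelSpace α := toModel α (kernelFun α w)

/-- The conjugate kernel `C_α k_w^α`, given by `(α(z) - α(w)) / (z - w)`, as an element of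
`K_α`. -/
def conjKernel (α : ℂ → ℂ) (w : ℂ) : modelSpace α :=
  toModel α (conjugation α (kernelFun α w))

/-- The rank-one operator `g ⊗ h : f ↦ ⟨f, h⟩ g` from `K_α` to `K_β`. -/
def tensor {α β : ℂ → ℂ} (g : modelSpace β) (h : modelSpace α) :
    modelSpace α →L[ℂ] modelSpace β :=
  InnerProductSpace.rankOne ℂ g h

end ATTO

end

noncomputable section

namespace ATTO

/-! ### The circle -/

/-! A finite-dimensional model space is invariant under the backward shift. Cayley–Hamilton for that
restriction gives a polynomial `q` of degree at most `m`, zero-free on the closed disk, with K_α =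
{p/q : deg p < m} and α = r/q on the closed disk (`exists_isRationalModel`). So α extends
continuously to the circle, and its radial limit exists at every boundary point.

Test an operator A on the functions z^i/q₁ of K_α against z^j/q₂ of K_β. If A has symbol φ, the
entry is the mean of φ z^(i-j)/(q₁ conj q₂), so it depends only on i - j. Conversely, every matrix
constant along diagonals comes from the symbol q₁ conj(q₂) times a Laurent polynomial
(`exists_entries_of_mem_toeplitz`, `mem_toeplitz_of_entries`). Thus 𝒯(α, β) is identified with the
vectors of m + n - 1 diagonal values.

The pairing with k_w turns multiplication by z, when it stays inside the model space, into
multiplication by w. The conjugate kernel obeys the reversed rule (`inner_kernel_shift`,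
`inner_conjKernel_shift`). Hence the diagonal values of each rank-one operator form a geometric
sequence with ratio w in (a), and a reversed one with ratio conj w in (b), with a nonzero factor in
front. Distinct points give independent sequences by Vandermonde, and their number equals the
dimension. Points of the circle need no separate treatment here. -/

theorem norm_pt (t : Torus) : ‖pt t‖ = 1 := Circle.norm_coe _

theorem pt_ne_zero (t : Torus) : pt t ≠ 0 := Circle.coe_ne_zero _

theorem continuous_pt : Continuous pt := by
  unfold pt
  exact continuous_subtype_val.comp AddCircle.continuous_toCircle

theorem star_pt (t : Torus) : star (pt t) = (pt t)⁻¹ := by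
  rw [Complex.inv_def, Complex.normSq_eq_norm_sq, norm_pt]; simp

theorem pt_mem_closedBall (t : Torus) : pt t ∈ Metric.closedBall (0 : ℂ) 1 := by
  simp [norm_pt]

theorem fourier_eq_pt_zpow (n : ℤ) (t : Torus) : fourier n t = pt t ^ n := by
  rw [fourier_apply, toCircle_zsmul]; simp [pt]

theorem pt_injective : Function.Injective pt := fun _ _ h =>
  AddCircle.injective_toCircle Real.two_pi_pos.ne' (Subtype.ext h)

theorem arc_singleton (t : Torus) : arc {t} = 0 := by
  have h := AddCircle.volume_closedBall (2 * Real.pi) (x := t) 0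
  rw [Metric.closedBall_zero, volume_eq_smul_haarAddCircle, Measure.smul_apply] at h
  simpa [Real.pi_pos.not_ge] using h

/-- This permits division by z - w and 1 - conj(w) z even when w lies on the circle. -/
theorem ae_pt_ne (w : ℂ) : ∀ᵐ t ∂arc, pt t ≠ w := by
  rw [ae_iff]
  have h : {t : Torus | ¬pt t ≠ w}.Subsingleton := fun a ha b hb =>
    pt_injective ((not_not.1 ha).trans (not_not.1 hb).symm)
  rcases h.eq_empty_or_singleton with h | ⟨t, h⟩
  · rw [h, measure_empty]
  · rw [h, arc_singleton]

theorem circleAverage_eq_integral (F : ℂ → ℂ) (R : ℝ) :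
    Real.circleAverage F 0 R = ∫ t, F (R * pt t) ∂arc := by
  rw [integral_haarAddCircle, ← AddCircle.intervalIntegral_preimage (2 * Real.pi) 0,
    Real.circleAverage]
  simp [circleMap, pt, AddCircle.toCircle_apply_mk, Circle.coe_exp]

/-! ### Boundary values -/

/-- The mean value property for radial limits of functions that are bounded near the circle. -/
theorem integral_radialLimit {F : ℂ → ℂ} (hF : DifferentiableOn ℂ F (Metric.ball 0 1)) {ρ C : ℝ}
    (hρ : ρ < 1) (hC : ∀ z : ℂ, ρ < ‖z‖ → ‖z‖ < 1 → ‖F z‖ ≤ C) {G : Torus → ℂ}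
    (hG : ∀ᵐ t ∂arc, Tendsto (fun r : ℝ => F (r * pt t)) (𝓝[<] 1) (𝓝 (G t))) :
    ∫ t, G t ∂arc = F 0 := by
  have hev : ∀ᶠ r : ℝ in 𝓝[<] 1, max ρ 0 < r ∧ r < 1 :=
    Ioo_mem_nhdsLT (by simp [hρ])
  -- Dominated convergence along the radii. For each r near 1 the integral is a circle average,
  -- hence equal to `F 0`.
  have key : Tendsto (fun r : ℝ => ∫ t, F (r * pt t) ∂arc) (𝓝[<] 1) (𝓝 (∫ t, G t ∂arc)) := by
    refine tendsto_integral_filter_of_dominated_convergence (fun _ => C) ?_ ?_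
      (integrable_const C) hG
    · filter_upwards [hev] with r hr
      have hr0 : 0 < r := (le_max_right _ _).trans_lt hr.1
      refine Continuous.aestronglyMeasurable ?_
      refine hF.continuousOn.comp_continuous (continuous_const.mul continuous_pt) fun t => ?_
      simp [norm_pt, abs_of_pos hr0, hr.2]
    · filter_upwards [hev] with r hr
      have hr0 : 0 < r := (le_max_right _ _).trans_lt hr.1
      refine Eventually.of_forall fun t => hC _ ?_ ?_
      · simpa [norm_pt, abs_of_pos hr0] using (le_max_left _ _).trans_lt hr.1
      · simpa [norm_pt, abs_of_pos hr0] using hr.2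
  refine tendsto_nhds_unique key (tendsto_const_nhds.congr' ?_)
  filter_upwards [hev] with r hr
  have hr0 : 0 < r := (le_max_right _ _).trans_lt hr.1
  rw [← circleAverage_eq_integral]
  refine (DiffContOnCl.circleAverage ?_).symm
  refine DifferentiableOn.diffContOnCl (hF.mono ?_)
  rw [abs_of_pos hr0, closure_ball _ hr0.ne']
  exact Metric.closedBall_subset_ball hr.2

theorem value_eq_of_tendsto {α : ℂ → ℂ} {w ζ : ℂ} (hw : ‖w‖ = 1)
    (h : Tendsto (fun r : ℝ => α (r * w)) (𝓝[<] (1 : ℝ)) (𝓝 ζ)) : value α w = ζ := by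
  rw [value, if_neg (by simp [hw])]
  exact h.limUnder_eq

theorem value_of_norm_lt {α : ℂ → ℂ} {w : ℂ} (hw : ‖w‖ < 1) : value α w = α w := if_pos hw

namespace IsInner

variable {α : ℂ → ℂ}

theorem tendsto_bdry (hα : IsInner α) :
    ∀ᵐ t ∂arc, Tendsto (fun r : ℝ => α (r * pt t)) (𝓝[<] 1) (𝓝 (bdry α t)) := by
  filter_upwards [hα.unimodular] with t ⟨ζ, _, h⟩
  rwa [bdry, value_eq_of_tendsto (norm_pt t) h]

theorem norm_bdry (hα : IsInner α) : ∀ᵐ t ∂arc, ‖bdry α t‖ = 1 := by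
  filter_upwards [hα.unimodular] with t ⟨ζ, hζ, h⟩
  rwa [bdry, value_eq_of_tendsto (norm_pt t) h]

theorem aestronglyMeasurable_bdry (hα : IsInner α) : AEStronglyMeasurable (bdry α) arc := by
  let v : ℕ → ℝ := fun n => 1 - ((n : ℝ) + 1)⁻¹
  have hv0 (n : ℕ) : 0 ≤ v n ∧ v n < 1 := by
    have h1 : ((n : ℝ) + 1)⁻¹ ≤ 1 := inv_le_one_of_one_le₀ (by linarith [n.cast_nonneg (α := ℝ)])
    have h2 : 0 < ((n : ℝ) + 1)⁻¹ := by positivity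
    constructor <;> simp only [v] <;> linarith
  have hv : Tendsto v atTop (𝓝[<] 1) := by
    refine tendsto_nhdsWithin_iff.2 ⟨?_, Eventually.of_forall fun n => (hv0 n).2⟩
    simpa [v] using tendsto_const_nhds.sub (tendsto_one_div_add_atTop_nhds_zero_nat (𝕜 := ℝ))
  refine aestronglyMeasurable_of_tendsto_ae atTop (f := fun n t => α (v n * pt t)) (fun n => ?_) ?_
  · refine Continuous.aestronglyMeasurable ?_
    refine hα.analytic.continuousOn.comp_continuous (continuous_const.mul continuous_pt) fun t => ?_
    simp [norm_pt, abs_of_nonneg (hv0 n).1, (hv0 n).2]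
  · filter_upwards [hα.tendsto_bdry] with t ht
    exact ht.comp hv

theorem memLp_bdry (hα : IsInner α) : MemLp (bdry α) ⊤ arc :=
  memLp_top_of_bound hα.aestronglyMeasurable_bdry 1 (hα.norm_bdry.mono fun _ h => h.le)

/-- The function α z^(n+1) is bounded and vanishes at the origin, so the mean of its radial limits
is 0. These means are the Fourier coefficients of negative index. -/
theorem integral_bdry_mul_pow (hα : IsInner α) (n : ℕ) :
    ∫ t, bdry α t * pt t ^ (n + 1) ∂arc = 0 := by
  obtain ⟨C, hC⟩ := hα.bounded
  have := integral_radialLimit (F := fun z => α z * z ^ (n + 1)) (ρ := 0) (C := C)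
    (G := fun t => bdry α t * pt t ^ (n + 1))
    (hα.analytic.mul (by fun_prop)) one_pos (fun z _ hz => ?_) ?_
  · simpa using this
  · have h1 := hC z (by simpa using hz)
    have h2 : ‖z‖ ^ (n + 1) ≤ 1 := pow_le_one₀ (norm_nonneg _) hz.le
    rw [norm_mul, norm_pow]
    exact (mul_le_mul h1 h2 (by positivity) ((norm_nonneg _).trans h1)).trans (by simp)
  · filter_upwards [hα.tendsto_bdry] with t ht
    refine ht.mul ?_
    have : Continuous fun r : ℝ => ((r : ℂ) * pt t) ^ (n + 1) := by fun_prop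
    simpa using (this.tendsto 1).mono_left nhdsWithin_le_nhds

/-- An inner function is determined in the open disk by its boundary values. -/
theorem eq_of_bdry_eq (hα : IsInner α) {h : ℂ → ℂ} (hd : DifferentiableOn ℂ h (Metric.ball 0 1))
    (hc : ContinuousOn h (Metric.closedBall 0 1)) (e : bdry α =ᵐ[arc] fun t => h (pt t))
    {w : ℂ} (hw : ‖w‖ < 1) : α w = h w := by
  obtain ⟨C, hC⟩ := hα.bounded
  obtain ⟨C', hC'⟩ := (isCompact_closedBall (0 : ℂ) 1).exists_bound_of_continuousOn hc
  have hwb : w ∈ Metric.ball (0 : ℂ) 1 := by simpa using hw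
  set F : ℂ → ℂ := fun z => α z - h z with hFdef
  have hF : DifferentiableOn ℂ F (Metric.ball 0 1) := hα.analytic.sub hd
  have hD : DifferentiableOn ℂ (dslope F w) (Metric.ball 0 1) :=
    (Complex.differentiableOn_dslope (Metric.isOpen_ball.mem_nhds hwb)).2 hF
  have hFb : ∀ z : ℂ, ‖z‖ < 1 → ‖F z‖ ≤ C + C' := fun z hz =>
    (norm_sub_le _ _).trans (add_le_add (hC z (by simpa using hz)) (hC' z (by simpa using hz.le)))
  -- the mean values of `z * (F z - F w) / (z - w)` and of `z / (z - w)`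
  have hlim (t : Torus) : Tendsto (fun r : ℝ => (r : ℂ) * pt t) (𝓝[<] 1) (𝓝 (pt t)) := by
    have : Continuous fun r : ℝ => (r : ℂ) * pt t := by fun_prop
    simpa using (this.tendsto 1).mono_left nhdsWithin_le_nhds
  have hne (t : Torus) : pt t ≠ w := fun hh => by
    have := norm_pt t; rw [hh] at this; linarith
  have h1 : ∫ t, pt t * ((0 - F w) / (pt t - w)) ∂arc = 0 := by
    -- The factor z makes the value at the origin 0. For ‖z‖ > (1 + ‖w‖)/2 the distance to w is at
    -- least (1 - ‖w‖)/2, which bounds the difference quotient. On the circle `F` has radial limit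
    -- 0, so only -F w remains in the numerator.
    have := integral_radialLimit (F := fun z => z * dslope F w z) (ρ := (1 + ‖w‖) / 2)
      (C := (C + C' + (C + C')) / ((1 - ‖w‖) / 2))
      (G := fun t => pt t * ((0 - F w) / (pt t - w)))
      (differentiableOn_id.mul hD) (by linarith) (fun z hz1 hz => ?_) ?_
    · simpa using this
    · have hzw : (1 - ‖w‖) / 2 ≤ ‖z - w‖ := by linarith [norm_sub_norm_le z w]
      have hzw' : z ≠ w := fun hh => by rw [hh, sub_self, norm_zero] at hzw; linarith
      rw [norm_mul, dslope_of_ne _ hzw', slope_def_field, norm_div]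
      calc ‖z‖ * (‖F z - F w‖ / ‖z - w‖) ≤ 1 * (‖F z - F w‖ / ‖z - w‖) := by gcongr
        _ = ‖F z - F w‖ / ‖z - w‖ := one_mul _
        _ ≤ _ := by
          have hn : ‖F z - F w‖ ≤ C + C' + (C + C') :=
            (norm_sub_le _ _).trans (add_le_add (hFb z hz) (hFb w hw))
          exact div_le_div₀ ((norm_nonneg _).trans hn) hn (by linarith) hzw
    · filter_upwards [hα.tendsto_bdry, e] with t ht het
      have hFlim : Tendsto (fun r : ℝ => F (r * pt t)) (𝓝[<] 1) (𝓝 0) := by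
        have hh : Tendsto (fun r : ℝ => h (r * pt t)) (𝓝[<] 1) (𝓝 (h (pt t))) := by
          refine (hc (pt t) (pt_mem_closedBall t)).tendsto.comp
            (tendsto_nhdsWithin_iff.2 ⟨hlim t, ?_⟩)
          filter_upwards [Ioo_mem_nhdsLT (zero_lt_one (α := ℝ))] with r hr
          simp [norm_pt, abs_of_pos hr.1, hr.2.le]
        simpa [het] using ht.sub hh
      have h3 : Tendsto (fun r : ℝ => (r : ℂ) * pt t * ((F (r * pt t) - F w) / (r * pt t - w)))
          (𝓝[<] 1) (𝓝 (pt t * ((0 - F w) / (pt t - w)))) :=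
        (hlim t).mul ((hFlim.sub_const _).div ((hlim t).sub_const _) (sub_ne_zero.2 (hne t)))
      refine h3.congr' ?_
      filter_upwards [(hlim t).eventually_ne (hne t)] with r hr
      rw [dslope_of_ne _ hr, slope_def_field]
  have h2 : ∫ t, pt t / (pt t - w) ∂arc = 1 := by
    have := DiffContOnCl.circleAverage_smul_div (f := fun _ : ℂ => (1 : ℂ)) (c := 0) (R := 1)
      (w := w) diffContOnCl_const (by simpa using hw)
    rw [circleAverage_eq_integral] at this
    simpa using this
  have h3 : ∫ t, pt t * ((0 - F w) / (pt t - w)) ∂arc = -F w := by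
    calc _ = ∫ t, -F w * (pt t / (pt t - w)) ∂arc := by congr 1; ext t; ring
      _ = _ := by rw [integral_const_mul, h2, mul_one]
  have : F w = 0 := neg_eq_zero.1 (h3.symm.trans h1)
  exact sub_eq_zero.1 this

/-- If the boundary function of an inner function agrees almost everywhere with a function that is
continuous on the closed disk and analytic inside, then the two agree on the closed disk. -/
theorem value_eq_of_bdry_eq (hα : IsInner α) {h : ℂ → ℂ}
    (hd : DifferentiableOn ℂ h (Metric.ball 0 1)) (hc : ContinuousOn h (Metric.closedBall 0 1))
    (e : bdry α =ᵐ[arc] fun t => h (pt t)) {w : ℂ} (hw : w ∈ Metric.closedBall (0 : ℂ) 1) :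
    value α w = h w := by
  rcases (show ‖w‖ ≤ 1 by simpa using hw).lt_or_eq with h1 | h1
  · rw [value_of_norm_lt h1, hα.eq_of_bdry_eq hd hc e h1]
  -- The limit exists at this particular point, not merely almost everywhere: α = h inside the disk
  -- and h is continuous up to the circle.
  · refine value_eq_of_tendsto h1 ?_
    have hev : ∀ᶠ r : ℝ in 𝓝[<] 1, ‖(r : ℂ) * w‖ < 1 := by
      filter_upwards [Ioo_mem_nhdsLT (zero_lt_one (α := ℝ))] with r hr
      simp [h1, abs_of_pos hr.1, hr.2]
    have hlim : Tendsto (fun r : ℝ => (r : ℂ) * w) (𝓝[<] 1) (𝓝[Metric.closedBall 0 1] w) := by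
      refine tendsto_nhdsWithin_iff.2 ⟨?_, hev.mono fun r hr => by simpa using hr.le⟩
      have : Continuous fun r : ℝ => (r : ℂ) * w := by fun_prop
      simpa using (this.tendsto 1).mono_left nhdsWithin_le_nhds
    refine ((hc w hw).tendsto.comp hlim).congr' ?_
    filter_upwards [hev] with r hr
    exact (hα.eq_of_bdry_eq hd hc e hr).symm

end IsInner

/-! ### Multiplication operators and Fourier coefficients -/

/-- Multiplication by a bounded function, as an operator on `L²`. -/
def mulOp (b : Torus → ℂ) (hb : MemLp b ⊤ arc) : L2 →ₗ[ℂ] L2 where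
  toFun f := ((Lp.memLp f).mul (p := ⊤) (q := 2) hb).toLp _
  map_add' f g := by
    rw [← MemLp.toLp_add]
    refine MemLp.toLp_congr _ _ ?_
    filter_upwards [Lp.coeFn_add f g] with t ht
    simp only [Pi.mul_apply, Pi.add_apply, ht, mul_add]
  map_smul' c f := by
    rw [RingHom.id_apply, ← MemLp.toLp_const_smul]
    refine MemLp.toLp_congr _ _ ?_
    filter_upwards [Lp.coeFn_smul c f] with t ht
    simp only [Pi.mul_apply, Pi.smul_apply, ht, smul_eq_mul]; ring

theorem coe_mulOp (b : Torus → ℂ) (hb : MemLp b ⊤ arc) (f : L2) :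
    mulOp b hb f =ᵐ[arc] fun t => b t * f t :=
  MemLp.coeFn_toLp ((Lp.memLp f).mul (p := ⊤) (q := 2) hb)

theorem memLp_of_continuous {b : Torus → ℂ} (hb : Continuous b) (p : ENNReal) : MemLp b p arc := by
  obtain ⟨C, hC⟩ := isCompact_univ.exists_bound_of_continuousOn hb.continuousOn
  exact (memLp_top_of_bound hb.aestronglyMeasurable C
    (Eventually.of_forall fun t => hC t trivial)).mono_exponent le_top

theorem inner_eq_integral (f g : L2) : inner ℂ f g = ∫ t, g t * star (f t) ∂arc := by
  rw [L2.inner_def]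
  simp [RCLike.inner_apply]

theorem fourierCoeff_eq_integral (f : Torus → ℂ) (n : ℤ) :
    fourierCoeff f n = ∫ t, pt t ^ (-n) * f t ∂arc := by
  simp only [fourierCoeff, fourier_eq_pt_zpow, smul_eq_mul]

theorem L2.ext_fourierCoeff {f g : L2} (h : ∀ n : ℤ, fourierCoeff (f : Torus → ℂ) n =
    fourierCoeff (g : Torus → ℂ) n) : f = g := by
  apply (fourierBasis (T := 2 * Real.pi)).repr.injective
  ext n
  rw [fourierBasis_repr, fourierBasis_repr, h]

/-- For `f, g ∈ H²` the mean value of `f g` is the product of the mean values. -/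
theorem integral_mul_of_mem_hardy {f g : L2} (hf : f ∈ hardy) (hg : g ∈ hardy) :
    ∫ t, f t * g t ∂arc =
      fourierCoeff (f : Torus → ℂ) 0 * fourierCoeff (g : Torus → ℂ) 0 := by
  set f' : L2 := (Lp.memLp f).star.toLp _ with hf'
  have e : (f' : Torus → ℂ) =ᵐ[arc] star (f : Torus → ℂ) := MemLp.coeFn_toLp _
  have h1 : inner ℂ f' g = ∫ t, f t * g t ∂arc := by
    rw [inner_eq_integral]
    refine integral_congr_ae ?_
    filter_upwards [e] with t ht
    rw [ht, Pi.star_apply, star_star, mul_comm]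
  have h2 (n : ℤ) : inner ℂ f' (fourierBasis (T := 2 * Real.pi) n) =
      fourierCoeff (f : Torus → ℂ) (-n) := by
    rw [coe_fourierBasis, inner_eq_integral, fourierCoeff_eq_integral]
    refine integral_congr_ae ?_
    filter_upwards [e, coeFn_fourierLp 2 n] with t ht h
    rw [ht, h, Pi.star_apply, star_star, fourier_eq_pt_zpow, neg_neg]
  have h3 (n : ℤ) : inner ℂ (fourierBasis (T := 2 * Real.pi) n) g =
      fourierCoeff (g : Torus → ℂ) n := by
    rw [← HilbertBasis.repr_apply_apply, fourierBasis_repr]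
  have h := (fourierBasis (T := 2 * Real.pi)).hasSum_inner_mul_inner f' g
  rw [← h1]
  refine h.unique ?_
  -- Parseval pairs the coefficient of index -n of f with that of index n of g. For n ≠ 0 one of the
  -- two indices is negative.
  have h0 := hasSum_single (f := fun n : ℤ => inner ℂ f' (fourierBasis (T := 2 * Real.pi) n) *
    inner ℂ (fourierBasis (T := 2 * Real.pi) n) g) 0 fun n hn => ?_
  · simpa only [h2, h3, neg_zero] using h0
  · rw [h2, h3]
    rcases lt_or_gt_of_ne hn with hn | hn
    · rw [hg n hn, mul_zero]
    · rw [hf (-n) (by omega), zero_mul]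

theorem memLp_pt (p : ENNReal) : MemLp pt p arc := memLp_of_continuous continuous_pt p

theorem memLp_star_pt (p : ENNReal) : MemLp (fun t => star (pt t)) p arc :=
  memLp_of_continuous (continuous_star.comp continuous_pt) p

/-- The bilateral shift, multiplication by `z`. -/
def shift : L2 →ₗ[ℂ] L2 := mulOp pt (memLp_pt ⊤)

/-- The inverse of the bilateral shift, multiplication by `conj z`. -/
def shiftInv : L2 →ₗ[ℂ] L2 := mulOp (fun t => star (pt t)) (memLp_star_pt ⊤)

theorem coe_shift (f : L2) : shift f =ᵐ[arc] fun t => pt t * f t := coe_mulOp _ _ f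

theorem coe_shiftInv (f : L2) : shiftInv f =ᵐ[arc] fun t => star (pt t) * f t := coe_mulOp _ _ f

theorem shift_shiftInv (f : L2) : shift (shiftInv f) = f := by
  refine Lp.ext ?_
  filter_upwards [coe_shift (shiftInv f), coe_shiftInv f] with t h1 h2
  rw [h1, h2, star_pt, mul_inv_cancel_left₀ (pt_ne_zero t)]

theorem fourierCoeff_shift (f : L2) (n : ℤ) : fourierCoeff (shift f : Torus → ℂ) n =
    fourierCoeff (f : Torus → ℂ) (n - 1) := by
  rw [fourierCoeff_eq_integral, fourierCoeff_eq_integral]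
  refine integral_congr_ae ?_
  filter_upwards [coe_shift f] with t ht
  rw [ht, neg_sub, sub_eq_add_neg, zpow_add₀ (pt_ne_zero t)]
  simp; ring

theorem fourierCoeff_shiftInv (f : L2) (n : ℤ) : fourierCoeff (shiftInv f : Torus → ℂ) n =
    fourierCoeff (f : Torus → ℂ) (n + 1) := by
  conv_rhs => rw [← shift_shiftInv f, fourierCoeff_shift]
  simp

theorem shift_mem_hardy {f : L2} (hf : f ∈ hardy) : shift f ∈ hardy := fun n hn => by
  rw [fourierCoeff_shift]; exact hf _ (by omega)

theorem fourierCoeff_shift_zero {f : L2} (hf : f ∈ hardy) :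
    fourierCoeff (shift f : Torus → ℂ) 0 = 0 := by
  rw [fourierCoeff_shift]; exact hf _ (by norm_num)

/-- The constant function `1` in `L²`. -/
def one : L2 := (memLp_const (1 : ℂ)).toLp _

theorem coe_one : one =ᵐ[arc] fun _ => (1 : ℂ) := MemLp.coeFn_toLp _

theorem fourierCoeff_one (n : ℤ) : fourierCoeff (one : Torus → ℂ) n = if n = 0 then 1 else 0 := by
  have h : (one : Torus → ℂ) =ᵐ[arc] fourier (T := 2 * Real.pi) 0 := by
    filter_upwards [coe_one] with t ht
    rw [ht, fourier_zero]
  rw [fourierCoeff_congr_ae h, fourierCoeff_fourier]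
  simp [Pi.single_apply]

theorem one_mem_hardy : one ∈ hardy := fun n hn => by
  rw [fourierCoeff_one, if_neg hn.ne]

theorem fourierCoeff_sub (f g : L2) (n : ℤ) : fourierCoeff ((f - g : L2) : Torus → ℂ) n =
    fourierCoeff (f : Torus → ℂ) n - fourierCoeff (g : Torus → ℂ) n := by
  simp only [← fourierBasis_repr, map_sub, lp.coeFn_sub, Pi.sub_apply]

theorem fourierCoeff_add (f g : L2) (n : ℤ) : fourierCoeff ((f + g : L2) : Torus → ℂ) n =
    fourierCoeff (f : Torus → ℂ) n + fourierCoeff (g : Torus → ℂ) n := by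
  simp only [← fourierBasis_repr, map_add, lp.coeFn_add, Pi.add_apply]

theorem fourierCoeff_smul (c : ℂ) (f : L2) (n : ℤ) : fourierCoeff ((c • f : L2) : Torus → ℂ) n =
    c * fourierCoeff (f : Torus → ℂ) n := by
  simp only [← fourierBasis_repr, map_smul, lp.coeFn_smul, Pi.smul_apply, smul_eq_mul]

/-- The backward shift `f ↦ conj z · (f - f(0))`. -/
def backShift : L2 →ₗ[ℂ] L2 where
  toFun f := shiftInv (f - fourierCoeff (f : Torus → ℂ) 0 • one)
  map_add' f g := by
    rw [← map_add, fourierCoeff_add]; congr 1; module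
  map_smul' c f := by
    rw [RingHom.id_apply, ← map_smul, fourierCoeff_smul]; congr 1; module

theorem shift_backShift (f : L2) :
    shift (backShift f) = f - fourierCoeff (f : Torus → ℂ) 0 • one := shift_shiftInv _

theorem fourierCoeff_backShift (f : L2) (n : ℤ) (hn : n ≠ -1) :
    fourierCoeff (backShift f : Torus → ℂ) n = fourierCoeff (f : Torus → ℂ) (n + 1) := by
  change fourierCoeff (shiftInv _ : Torus → ℂ) n = _
  rw [fourierCoeff_shiftInv, fourierCoeff_sub, fourierCoeff_smul, fourierCoeff_one,
    if_neg (by omega)]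
  simp

theorem backShift_mem_hardy {f : L2} (hf : f ∈ hardy) : backShift f ∈ hardy := fun n hn => by
  rcases eq_or_ne n (-1) with rfl | h
  · change fourierCoeff (shiftInv _ : Torus → ℂ) (-1) = _
    rw [fourierCoeff_shiftInv, fourierCoeff_sub, fourierCoeff_smul, fourierCoeff_one]
    simp
  · rw [fourierCoeff_backShift f n h]; exact hf _ (by omega)

/-! ### Inner functions and model spaces -/

variable {α : ℂ → ℂ}

/-- The boundary function of an inner function as an element of `L²`. -/
def IsInner.bdryL (hα : IsInner α) : L2 :=
  (hα.memLp_bdry.mono_exponent (p := 2) le_top).toLp _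

theorem IsInner.coe_bdryL (hα : IsInner α) : hα.bdryL =ᵐ[arc] bdry α := MemLp.coeFn_toLp _

theorem IsInner.bdryL_mem_hardy (hα : IsInner α) : hα.bdryL ∈ hardy := fun n hn => by
  obtain ⟨k, rfl⟩ : ∃ k : ℕ, n = -((k : ℤ) + 1) := ⟨(-n - 1).toNat, by omega⟩
  rw [fourierCoeff_congr_ae hα.coe_bdryL, fourierCoeff_eq_integral, ← hα.integral_bdry_mul_pow k]
  congr 1; ext t
  rw [neg_neg, mul_comm]; norm_cast

/-- Multiplication by the boundary function of an inner function. -/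
def IsInner.mul (hα : IsInner α) : L2 →ₗ[ℂ] L2 := mulOp (bdry α) hα.memLp_bdry

theorem IsInner.coe_mul (hα : IsInner α) (f : L2) : hα.mul f =ᵐ[arc] fun t => bdry α t * f t :=
  coe_mulOp _ _ f

theorem IsInner.mul_mem_mulHardy (hα : IsInner α) {f : L2} (hf : f ∈ hardy) :
    hα.mul f ∈ mulHardy α := ⟨f, hf, hα.coe_mul f⟩

theorem IsInner.exists_of_mem_mulHardy (hα : IsInner α) {g : L2} (hg : g ∈ mulHardy α) :
    ∃ f ∈ hardy, g = hα.mul f := by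
  obtain ⟨f, hf, h⟩ := hg
  exact ⟨f, hf, Lp.ext (h.trans (hα.coe_mul f).symm)⟩

theorem IsInner.mul_one (hα : IsInner α) : hα.mul one = hα.bdryL := by
  refine Lp.ext ?_
  filter_upwards [hα.coe_mul one, coe_one, hα.coe_bdryL] with t h1 h2 h3
  rw [h1, h2, h3, _root_.mul_one]

theorem IsInner.mul_shift (hα : IsInner α) (f : L2) : hα.mul (shift f) = shift (hα.mul f) := by
  refine Lp.ext ?_
  filter_upwards [hα.coe_mul (shift f), coe_shift f, coe_shift (hα.mul f), hα.coe_mul f]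
    with t h1 h2 h3 h4
  rw [h1, h2, h3, h4]; ring

theorem iterate_shift_mem_hardy {f : L2} (hf : f ∈ hardy) (k : ℕ) : (shift ^ k) f ∈ hardy := by
  induction k with
  | zero => exact hf
  | succ k ih => rw [pow_succ']; exact shift_mem_hardy ih

theorem coe_shift_pow (f : L2) (k : ℕ) : (shift ^ k) f =ᵐ[arc] fun t => pt t ^ k * f t := by
  induction k with
  | zero => simp
  | succ k ih =>
    rw [pow_succ', Module.End.mul_apply]
    filter_upwards [ih, coe_shift ((shift ^ k) f)] with t h1 h2
    rw [h2, h1]; ring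

/-- The coefficient of index -(k+1) of αf is the mean of α · z^(k+1) f. Both factors are in H² and
the second has mean 0. -/
theorem IsInner.mul_mem_hardy (hα : IsInner α) {f : L2} (hf : f ∈ hardy) : hα.mul f ∈ hardy :=
  fun n hn => by
    obtain ⟨k, rfl⟩ : ∃ k : ℕ, n = -((k : ℤ) + 1) := ⟨(-n - 1).toNat, by omega⟩
    have h := integral_mul_of_mem_hardy hα.bdryL_mem_hardy
      (shift_mem_hardy (iterate_shift_mem_hardy hf k))
    rw [fourierCoeff_shift_zero (iterate_shift_mem_hardy hf k), mul_zero] at h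
    rw [fourierCoeff_eq_integral, ← h]
    refine integral_congr_ae ?_
    filter_upwards [hα.coe_mul f, coe_shift ((shift ^ k) f), coe_shift_pow f k, hα.coe_bdryL]
      with t h1 h2 h3 h4
    rw [h1, h2, h3, h4, neg_neg]
    norm_cast
    ring

theorem mem_modelSpace_iff (hα : IsInner α) {f : L2} : f ∈ modelSpace α ↔
    f ∈ hardy ∧ ∀ g ∈ hardy, inner ℂ (hα.mul g) f = 0 := by
  refine and_congr_right fun _ => ?_
  rw [SetLike.mem_coe, Submodule.mem_orthogonal]
  refine ⟨fun h g hg => h _ (hα.mul_mem_mulHardy hg), fun h u hu => ?_⟩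
  obtain ⟨g, hg, rfl⟩ := hα.exists_of_mem_mulHardy hu
  exact h g hg

theorem inner_mul_bdryL (hα : IsInner α) (f : L2) :
    inner ℂ hα.bdryL (hα.mul f) = fourierCoeff (f : Torus → ℂ) 0 := by
  rw [inner_eq_integral, fourierCoeff_eq_integral]
  refine integral_congr_ae ?_
  filter_upwards [hα.coe_mul f, hα.coe_bdryL, hα.norm_bdry] with t h1 h2 h3
  rw [h1, h2, mul_right_comm, Complex.star_def, Complex.mul_conj, Complex.normSq_eq_norm_sq, h3]
  simp

theorem inner_one (f : L2) : inner ℂ one f = fourierCoeff (f : Torus → ℂ) 0 := by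
  rw [inner_eq_integral, fourierCoeff_eq_integral]
  refine integral_congr_ae ?_
  filter_upwards [coe_one] with t h1
  simp [h1]

theorem inner_shift_left (f g : L2) : inner ℂ (shift f) g = inner ℂ f (shiftInv g) := by
  rw [inner_eq_integral, inner_eq_integral]
  refine integral_congr_ae ?_
  filter_upwards [coe_shift f, coe_shiftInv g] with t h1 h2
  rw [h1, h2, star_mul']; ring

/-- If `f ∈ H²` is orthogonal to `z α H²`, its backward shift is in the model space. -/
theorem backShift_mem_modelSpace_of (hα : IsInner α) {f : L2} (hf : f ∈ hardy)
    (h : ∀ g ∈ hardy, inner ℂ (hα.mul (shift g)) f = 0) : backShift f ∈ modelSpace α := by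
  refine (mem_modelSpace_iff hα).2 ⟨backShift_mem_hardy hf, fun g hg => ?_⟩
  change inner ℂ _ (shiftInv _) = _
  -- Moving conj z across the inner product leaves the pairings of zαg with f and with the constant
  -- f(0). The first vanishes by hypothesis, the second because zαg has mean 0.
  rw [← inner_shift_left, inner_sub_right, inner_smul_right, ← hα.mul_shift, h g hg,
    ← inner_conj_symm, inner_one, hα.mul_shift, fourierCoeff_shift_zero (hα.mul_mem_hardy hg)]
  simp

theorem backShift_mem_modelSpace (hα : IsInner α) {f : L2} (hf : f ∈ modelSpace α) :
    backShift f ∈ modelSpace α :=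
  have h := (mem_modelSpace_iff hα).1 hf
  backShift_mem_modelSpace_of hα h.1 fun _ hg => h.2 _ (shift_mem_hardy hg)

theorem backShift_bdryL_mem_modelSpace (hα : IsInner α) : backShift hα.bdryL ∈ modelSpace α :=
  backShift_mem_modelSpace_of hα hα.bdryL_mem_hardy fun g hg => by
    rw [← inner_conj_symm, inner_mul_bdryL, fourierCoeff_shift_zero hg, map_zero]

/-- The boundary function of `α` is orthogonal to the model space. -/
theorem inner_bdryL_modelSpace (hα : IsInner α) {f : L2} (hf : f ∈ modelSpace α) :
    inner ℂ hα.bdryL f = 0 := by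
  rw [← hα.mul_one]
  exact ((mem_modelSpace_iff hα).1 hf).2 _ one_mem_hardy

/-- The conjugation `f ↦ α · conj z · conj f` preserves the model space. -/
theorem conjugation_mem_modelSpace (hα : IsInner α) {f g : L2} (hf : f ∈ modelSpace α)
    (hg : g =ᵐ[arc] conjugation α f) : g ∈ modelSpace α := by
  have hf' := (mem_modelSpace_iff hα).1 hf
  refine (mem_modelSpace_iff hα).2 ⟨fun n hn => ?_, fun h hh => ?_⟩
  · obtain ⟨k, rfl⟩ : ∃ k : ℕ, n = -((k : ℤ) + 1) := ⟨(-n - 1).toNat, by omega⟩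
    have e := hf'.2 _ (iterate_shift_mem_hardy one_mem_hardy k)
    rw [← inner_conj_symm, map_eq_zero] at e
    rw [fourierCoeff_eq_integral, ← e, inner_eq_integral]
    refine integral_congr_ae ?_
    filter_upwards [hg, hα.coe_mul ((shift ^ k) one), coe_shift_pow one k, coe_one]
      with t h1 h2 h3 h4
    rw [h1, h2, h3, h4, conjugation, neg_neg, star_pt]
    have := pt_ne_zero t
    norm_cast
    rw [pow_succ]
    field_simp
  · have e := integral_mul_of_mem_hardy hf'.1 (shift_mem_hardy hh)
    rw [fourierCoeff_shift_zero hh, mul_zero] at e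
    rw [← inner_conj_symm, map_eq_zero, ← e, inner_eq_integral]
    refine integral_congr_ae ?_
    filter_upwards [hg, hα.coe_mul h, coe_shift h, hα.norm_bdry] with t h1 h2 h3 h4
    have h5 : bdry α t * star (bdry α t) = 1 := by
      rw [Complex.star_def, Complex.mul_conj, Complex.normSq_eq_norm_sq, h4]; simp
    rw [h1, h2, h3, conjugation, star_mul', star_mul', star_star, star_star]
    linear_combination (f t * pt t * h t) * h5

open Polynomial in
/-- The rational function `p / q` on the circle. -/
def ratFun (p q : ℂ[X]) (t : Torus) : ℂ := p.eval (pt t) / q.eval (pt t)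

open Polynomial in
/-- The description of a finite-dimensional model space and of its inner function in terms of
polynomials: `K_α = {p / q : deg p < m}` and `α = r / q` on the closed disk. -/
structure IsRationalModel (α : ℂ → ℂ) (m : ℕ) (q r : ℂ[X]) : Prop where
  eval_ne_zero : ∀ z ∈ Metric.closedBall (0 : ℂ) 1, q.eval z ≠ 0
  natDegree_den_le : q.natDegree ≤ m
  natDegree_num_le : r.natDegree ≤ m
  mem_iff : ∀ f : L2, f ∈ modelSpace α ↔ ∃ p : ℂ[X], p.degree < m ∧ f =ᵐ[arc] ratFun p q
  value_eq : ∀ z ∈ Metric.closedBall (0 : ℂ) 1, value α z = r.eval z / q.eval z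

/-! ### Rational form of a finite-dimensional model space -/

section Denominator

open Polynomial

theorem coe_aeval_shift (p : ℂ[X]) (f : L2) :
    aeval shift p f =ᵐ[arc] fun t => p.eval (pt t) * f t := by
  induction p using Polynomial.induction_on' with
  | add p q hp hq =>
    rw [map_add, LinearMap.add_apply]
    filter_upwards [Lp.coeFn_add (aeval shift p f) (aeval shift q f), hp, hq] with t h h1 h2
    rw [h, Pi.add_apply, h1, h2, eval_add, add_mul]
  | monomial n a =>
    rw [aeval_monomial, ← Algebra.smul_def, LinearMap.smul_apply]
    filter_upwards [Lp.coeFn_smul a ((shift ^ n) f), coe_shift_pow f n] with t h h1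
    rw [h, Pi.smul_apply, h1, smul_eq_mul, eval_monomial, mul_assoc]

/-- Taylor's formula: each backward shift splits off one more coefficient, and these make up the
polynomial. -/
theorem exists_shift_pow_backShift_pow (i : ℕ) (f : L2) : ∃ p : ℂ[X], p.degree < i ∧
    f = (shift ^ i) ((backShift ^ i) f) + aeval shift p one := by
  induction i with
  | zero => exact ⟨0, by simp, by simp⟩
  | succ i ih =>
    obtain ⟨p, hp, h⟩ := ih
    set g := (backShift ^ i) f with hg
    refine ⟨p + C (fourierCoeff (g : Torus → ℂ) 0) * X ^ i, ?_, ?_⟩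
    · refine (degree_add_le _ _).trans_lt (max_lt (hp.trans (by exact_mod_cast i.lt_succ_self)) ?_)
      exact (degree_C_mul_X_pow_le i _).trans_lt (by exact_mod_cast i.lt_succ_self)
    · have e : (shift ^ (i + 1)) ((backShift ^ (i + 1)) f) =
          (shift ^ i) g - fourierCoeff (g : Torus → ℂ) 0 • (shift ^ i) one := by
        rw [pow_succ shift, pow_succ' backShift, Module.End.mul_apply, Module.End.mul_apply,
          shift_backShift, map_sub, map_smul]
      rw [e, map_add, map_mul, aeval_C, map_pow, aeval_X, ← Algebra.smul_def, LinearMap.add_apply,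
        LinearMap.smul_apply]
      conv_lhs => rw [h]
      abel

/-- An eigenvector of the backward shift in `H²` has an eigenvalue in the open disk. -/
theorem norm_lt_one_of_backShift_eq {f : L2} (hf : f ∈ hardy) (h0 : f ≠ 0) {c : ℂ}
    (h : backShift f = c • f) : ‖c‖ < 1 := by
  by_contra! hc
  -- The coefficients form a geometric sequence of ratio c. If ‖c‖ ≥ 1, square summability forces
  -- the first one, hence all, to vanish.
  have hcoeff (n : ℕ) : fourierCoeff (f : Torus → ℂ) n =
      c ^ n * fourierCoeff (f : Torus → ℂ) 0 := by
    induction n with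
    | zero => simp
    | succ n ih =>
      rw [Nat.cast_succ, ← fourierCoeff_backShift f n (by omega), h, fourierCoeff_smul, ih]
      ring
  have hs : Tendsto (fun n : ℕ => ‖fourierCoeff (f : Torus → ℂ) n‖ ^ 2) atTop (𝓝 0) :=
    ((hasSum_sq_fourierCoeff f).summable.comp_injective
      Nat.cast_injective).tendsto_atTop_zero
  have hle : ‖fourierCoeff (f : Torus → ℂ) 0‖ ^ 2 ≤ 0 := by
    refine ge_of_tendsto hs (Eventually.of_forall fun n => ?_)
    rw [hcoeff, norm_mul, norm_pow]
    gcongr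
    exact le_mul_of_one_le_left (norm_nonneg _) (one_le_pow₀ hc)
  have hz : fourierCoeff (f : Torus → ℂ) 0 = 0 := by
    rw [← norm_eq_zero]; exact pow_eq_zero_iff two_ne_zero |>.1 (le_antisymm hle (by positivity))
  refine h0 (L2.ext_fourierCoeff fun n => ?_)
  have hzero : fourierCoeff ((0 : L2) : Torus → ℂ) n = 0 := by
    rw [← fourierBasis_repr]; simp
  rw [hzero]
  rcases lt_or_ge n 0 with hn | hn
  · exact hf n hn
  · lift n to ℕ using hn
    rw [hcoeff, hz, mul_zero]

/-- Cayley–Hamilton for the backward shift on K_α, combined with Taylor's formula: the reversed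
characteristic polynomial clears every denominator. -/
theorem exists_denominator (hα : IsInner α) [FiniteDimensional ℂ (modelSpace α)] {m : ℕ}
    (hm : Module.finrank ℂ (modelSpace α) = m) : ∃ q : ℂ[X], q.natDegree ≤ m ∧
      (∀ z ∈ Metric.closedBall (0 : ℂ) 1, q.eval z ≠ 0) ∧
      ∀ f ∈ modelSpace α, ∃ p : ℂ[X], p.degree < m ∧ f =ᵐ[arc] ratFun p q := by
  set T : Module.End ℂ (modelSpace α) :=
    backShift.restrict fun f hf => backShift_mem_modelSpace hα hf with hT
  have hTpow (i : ℕ) (f : modelSpace α) : ((T ^ i) f : L2) = (backShift ^ i) f := by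
    induction i with
    | zero => rfl
    | succ i ih => rw [pow_succ', pow_succ', Module.End.mul_apply, Module.End.mul_apply, ← ih]; rfl
  have hdeg : T.charpoly.natDegree = m := by rw [LinearMap.charpoly_natDegree, hm]
  set c : ℕ → ℂ := T.charpoly.coeff with hc
  have hcm : c m = 1 := by
    rw [hc, ← hdeg]; exact T.charpoly_monic.coeff_natDegree
  -- This is z^m χ(1/z), with χ the characteristic polynomial. Since χ is monic, q(0) = 1, and a
  -- zero z of q in the closed disk would give an eigenvalue 1/z of modulus at least 1.
  set q : ℂ[X] := ∑ i ∈ Finset.range (m + 1), C (c i) * X ^ (m - i) with hq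
  have hroots : ∀ z ∈ Metric.closedBall (0 : ℂ) 1, q.eval z ≠ 0 := by
    intro z hz h
    have hz0 : z ≠ 0 := by
      rintro rfl
      rw [hq, eval_finsetSum, Finset.sum_range_succ, Finset.sum_eq_zero] at h
      · simp [hcm] at h
      · intro i hi
        have : m - i ≠ 0 := by have := Finset.mem_range.1 hi; omega
        simp [this]
    have hroot : T.charpoly.IsRoot z⁻¹ := by
      have e : q.eval z = z ^ m * T.charpoly.eval z⁻¹ := by
        rw [hq, eval_finsetSum, eval_eq_sum_range, hdeg, Finset.mul_sum]
        refine Finset.sum_congr rfl fun i hi => ?_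
        have hi' : i ≤ m := by have := Finset.mem_range.1 hi; omega
        rw [eval_mul, eval_C, eval_pow, eval_X, pow_sub₀ z hz0 hi', inv_pow]; ring
      rw [e] at h
      exact (mul_eq_zero.1 h).resolve_left (pow_ne_zero _ hz0)
    obtain ⟨v, hv⟩ :=
      ((Module.End.hasEigenvalue_iff_isRoot_charpoly T _).2 hroot).exists_hasEigenvector
    have hv1 : backShift (v : L2) = z⁻¹ • (v : L2) := congrArg Subtype.val hv.apply_eq_smul
    have hlt := norm_lt_one_of_backShift_eq v.2.1 (fun h0 => hv.2 (Subtype.ext h0)) hv1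
    rw [norm_inv] at hlt
    have h1 : ‖z‖ ≤ 1 := by simpa using hz
    exact absurd ((one_le_inv₀ (norm_pos_iff.2 hz0)).2 h1) (not_le.2 hlt)
  refine ⟨q, ?_, hroots, fun f hf => ?_⟩
  · refine natDegree_sum_le_of_forall_le _ _ fun i _ => ?_
    exact (natDegree_C_mul_X_pow_le _ _).trans (Nat.sub_le _ _)
  · choose p hp hpf using fun i => exists_shift_pow_backShift_pow i f
    have hCH : ∑ i ∈ Finset.range (m + 1), c i • (backShift ^ i) f = 0 := by
      have h := congrArg (fun S : Module.End ℂ (modelSpace α) => ((S ⟨f, hf⟩ : modelSpace α) : L2))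
        T.aeval_self_charpoly
      rw [aeval_eq_sum_range, hdeg] at h
      simpa [LinearMap.sum_apply, hTpow] using h
    -- Multiply the i-th Taylor formula by c_i z^(m-i) and sum over i. The remainders add up to z^m
    -- χ(B) f = 0, where B is the backward shift, and each surviving polynomial has degree below m.
    have key : aeval shift q f =
        aeval shift (∑ i ∈ Finset.range (m + 1), C (c i) * X ^ (m - i) * p i) one := by
      have hterm : ∀ i ∈ Finset.range (m + 1), aeval shift (C (c i) * X ^ (m - i)) f =
          (shift ^ m) (c i • (backShift ^ i) f) +
            aeval shift (C (c i) * X ^ (m - i) * p i) one := by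
        intro i hi
        have hi' : i ≤ m := by have := Finset.mem_range.1 hi; omega
        conv_lhs => rw [hpf i]
        rw [map_add]
        congr 1
        · rw [map_mul, aeval_C, map_pow, aeval_X, ← Algebra.smul_def, LinearMap.smul_apply,
            ← Module.End.mul_apply, ← pow_add, Nat.sub_add_cancel hi', map_smul]
        · rw [map_mul (aeval shift) _ (p i), Module.End.mul_apply]
      rw [hq, map_sum, map_sum, LinearMap.sum_apply, LinearMap.sum_apply, Finset.sum_congr rfl hterm,
        Finset.sum_add_distrib, ← map_sum, hCH, map_zero, zero_add]
    refine ⟨∑ i ∈ Finset.range (m + 1), C (c i) * X ^ (m - i) * p i, ?_, ?_⟩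
    · refine (degree_sum_le _ _).trans_lt ((Finset.sup_lt_iff (WithBot.bot_lt_coe m)).2 fun i hi => ?_)
      have hi' : i ≤ m := by have := Finset.mem_range.1 hi; omega
      rcases eq_or_ne (p i) 0 with h0 | h0
      · rw [h0, mul_zero, degree_zero]; exact WithBot.bot_lt_coe m
      have hpi : (p i).natDegree < i := (natDegree_lt_iff_degree_lt h0).2 (hp i)
      refine degree_le_natDegree.trans_lt ?_
      have h2 := (natDegree_mul_le (p := C (c i) * X ^ (m - i)) (q := p i)).trans
        (Nat.add_le_add_right (natDegree_C_mul_X_pow_le (c i) (m - i)) _)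
      exact Nat.cast_lt.2 (by omega)
    · filter_upwards [coe_aeval_shift q f, coe_one, coe_aeval_shift
        (∑ i ∈ Finset.range (m + 1), C (c i) * X ^ (m - i) * p i) one] with t h1 h2 h3
      rw [key, h3, h2, mul_one] at h1
      rw [ratFun, h1, mul_div_cancel_left₀ _ (hroots _ (pt_mem_closedBall t))]

theorem continuous_ratFun {q : ℂ[X]} (hq : ∀ z ∈ Metric.closedBall (0 : ℂ) 1, q.eval z ≠ 0)
    (p : ℂ[X]) : Continuous (ratFun p q) :=
  (p.continuous.comp continuous_pt).div (q.continuous.comp continuous_pt)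
    fun t => hq _ (pt_mem_closedBall t)

/-- The linear map `p ↦ p / q` from polynomials to `L²`. -/
def ratL (q : ℂ[X]) (hq : ∀ z ∈ Metric.closedBall (0 : ℂ) 1, q.eval z ≠ 0) : ℂ[X] →ₗ[ℂ] L2 where
  toFun p := (memLp_of_continuous (continuous_ratFun hq p) 2).toLp _
  map_add' p₁ p₂ := by
    rw [← MemLp.toLp_add]
    refine MemLp.toLp_congr _ _ (Eventually.of_forall fun t => ?_)
    simp [ratFun, add_div]
  map_smul' c p := by
    rw [RingHom.id_apply, ← MemLp.toLp_const_smul]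
    refine MemLp.toLp_congr _ _ (Eventually.of_forall fun t => ?_)
    simp [ratFun, mul_div_assoc]

theorem coe_ratL {q : ℂ[X]} (hq : ∀ z ∈ Metric.closedBall (0 : ℂ) 1, q.eval z ≠ 0) (p : ℂ[X]) :
    ratL q hq p =ᵐ[arc] ratFun p q :=
  MemLp.coeFn_toLp (memLp_of_continuous (continuous_ratFun hq p) 2)

/-- The backward shift of α lies in K_α, so it equals p/q. Then α = c + z p/q with c the mean of α,
which gives the numerator c q + z p. -/
theorem exists_isRationalModel (hα : IsInner α) [FiniteDimensional ℂ (modelSpace α)] {m : ℕ}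
    (hm : Module.finrank ℂ (modelSpace α) = m) :
    ∃ q r : ℂ[X], IsRationalModel α m q r := by
  obtain ⟨q, hdq, hq, hf⟩ := exists_denominator hα hm
  obtain ⟨p, hp, hpe⟩ := hf _ (backShift_bdryL_mem_modelSpace hα)
  set c := fourierCoeff (hα.bdryL : Torus → ℂ) 0 with hc
  have hdr : (C c * q + X * p).natDegree ≤ m := by
    refine (natDegree_add_le _ _).trans (max_le ((natDegree_C_mul_le _ _).trans hdq) ?_)
    rcases eq_or_ne p 0 with rfl | h0
    · simp
    · have := (natDegree_lt_iff_degree_lt h0).2 hp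
      refine natDegree_mul_le.trans ?_
      rw [natDegree_X]; omega
  refine ⟨q, C c * q + X * p, hq, hdq, hdr, ?_, fun z hz => ?_⟩
  · have hle : modelSpace α ≤ (degreeLT ℂ m).map (ratL q hq) := by
      intro f hfm
      obtain ⟨p', hp', he⟩ := hf f hfm
      exact ⟨p', mem_degreeLT.2 hp', Lp.ext ((coe_ratL hq p').trans he.symm)⟩
    have hfin : Module.Finite ℂ (degreeLT ℂ m) :=
      Module.Finite.equiv (degreeLTEquiv ℂ m).symm
    have heq : modelSpace α = (degreeLT ℂ m).map (ratL q hq) := by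
      refine Submodule.eq_of_le_of_finrank_le hle ((Submodule.finrank_map_le _ _).trans ?_)
      rw [hm, (degreeLTEquiv ℂ m).finrank_eq, Module.finrank_fin_fun]
    intro f
    refine ⟨hf f, fun ⟨p', hp', he⟩ => ?_⟩
    rw [heq]
    exact ⟨p', mem_degreeLT.2 hp', Lp.ext ((coe_ratL hq p').trans he.symm)⟩
  · refine hα.value_eq_of_bdry_eq (h := fun z => (C c * q + X * p).eval z / q.eval z) ?_ ?_ ?_ hz
    · exact (Polynomial.differentiable _).differentiableOn.div
        (Polynomial.differentiable _).differentiableOn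
        fun z hz => hq z (Metric.ball_subset_closedBall hz)
    · exact (Polynomial.continuous _).continuousOn.div (Polynomial.continuous _).continuousOn hq
    · have e : hα.bdryL = shift (backShift hα.bdryL) + c • one := by rw [shift_backShift]; abel
      have e' := Lp.coeFn_add (shift (backShift hα.bdryL)) (c • one)
      rw [← e] at e'
      filter_upwards [hα.coe_bdryL, e', coe_shift (backShift hα.bdryL), hpe, coe_one,
        Lp.coeFn_smul c one] with t h1 h2 h3 h4 h5 h6
      have hqt := hq _ (pt_mem_closedBall t)
      rw [← h1, h2, Pi.add_apply, h3, h4, h6, Pi.smul_apply, h5, ratFun, eval_add, eval_mul,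
        eval_C, eval_mul, eval_X]
      simp only [smul_eq_mul]
      field_simp
      ring

end Denominator

/-! ### Kernels -/

/-- Once a representative in the model space is exhibited, the default value 0 of `toModel` plays no
role. -/
theorem coe_toModel {α : ℂ → ℂ} {u : Torus → ℂ} {f : L2} (hf : f ∈ modelSpace α)
    (h : f =ᵐ[arc] u) : (toModel α u : L2) =ᵐ[arc] u := by
  have hex : ∃ f : modelSpace α, ((f : L2) : Torus → ℂ) =ᵐ[arc] u := ⟨⟨f, hf⟩, h⟩
  rw [toModel, dif_pos hex]
  exact hex.choose_spec

theorem one_sub_star_mul_pt_ne_zero {w : ℂ} {t : Torus} (h : pt t ≠ w) :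
    1 - star w * pt t ≠ 0 := by
  intro h0
  have h1 : 1 - w * star (pt t) = 0 := by
    rw [← star_inj]; simpa [mul_comm] using h0
  rw [star_pt, sub_eq_zero, eq_mul_inv_iff_mul_eq₀ (pt_ne_zero t), one_mul] at h1
  exact h h1

theorem IsInner.bdry_mul_star (hα : IsInner α) :
    ∀ᵐ t ∂arc, bdry α t * star (bdry α t) = 1 := by
  filter_upwards [hα.norm_bdry] with t h
  rw [Complex.star_def, Complex.mul_conj, Complex.normSq_eq_norm_sq, h]; simp

/-- The conjugate kernel is the difference quotient of `α`. -/
theorem conjugation_kernelFun (hα : IsInner α) (w : ℂ) :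
    conjugation α (kernelFun α w) =ᵐ[arc] fun t => (bdry α t - value α w) / (pt t - w) := by
  filter_upwards [hα.bdry_mul_star, ae_pt_ne w] with t h1 h2
  have h3 := star_ne_zero.2 (one_sub_star_mul_pt_ne_zero h2)
  simp only [conjugation, kernelFun, star_div₀]
  simp only [star_sub, star_one, star_mul', star_star, star_pt] at h3 ⊢
  have h4 := pt_ne_zero t
  rw [mul_div_assoc', div_eq_div_iff h3 (sub_ne_zero.2 h2)]
  field_simp
  linear_combination (-value α w) * h1

theorem conjugation_conjugation (hα : IsInner α) (f : Torus → ℂ) :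
    conjugation α (conjugation α f) =ᵐ[arc] f := by
  filter_upwards [hα.bdry_mul_star] with t h1
  simp only [conjugation, star_mul', star_star]
  have h2 : star (pt t) * pt t = 1 := by rw [star_pt, inv_mul_cancel₀ (pt_ne_zero t)]
  linear_combination (star (pt t) * pt t * f t) * h1 + f t * h2

theorem conjugation_congr {f g : Torus → ℂ} (h : f =ᵐ[arc] g) :
    conjugation α f =ᵐ[arc] conjugation α g := by
  filter_upwards [h] with t ht
  rw [conjugation, conjugation, ht]

/-! ### Kernels tested against the functions z^i/q -/

section Model

open Polynomial

variable {m : ℕ} {q r : ℂ[X]}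

theorem IsRationalModel.coe_conjKernel (hM : IsRationalModel α m q r) (hα : IsInner α)
    {w : ℂ} (hw : w ∈ Metric.closedBall (0 : ℂ) 1) :
    (conjKernel α w : L2) =ᵐ[arc] conjugation α (kernelFun α w) := by
  -- Up to the factor q(w) q this is α - α(w). It vanishes at w, so dividing by z - w lowers the
  -- degree below m and the difference quotient has the form p/q.
  set u : ℂ[X] := C (q.eval w) * r - C (r.eval w) * q with hu
  have hu0 : u.IsRoot w := by simp [hu, mul_comm]
  obtain ⟨s, hs⟩ := dvd_iff_isRoot.2 hu0
  have hsdeg : (C (q.eval w)⁻¹ * s).degree < m := by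
    rcases eq_or_ne s 0 with rfl | h0
    · simp
    have h1 : u.natDegree ≤ m := (natDegree_sub_le _ _).trans
      (max_le ((natDegree_C_mul_le _ _).trans hM.natDegree_num_le)
        ((natDegree_C_mul_le _ _).trans hM.natDegree_den_le))
    rw [hs, natDegree_mul (X_sub_C_ne_zero w) h0, natDegree_X_sub_C] at h1
    rw [degree_C_mul (inv_ne_zero (hM.eval_ne_zero _ hw))]
    exact (natDegree_lt_iff_degree_lt h0).1 (by omega)
  refine coe_toModel (f := ratL q hM.eval_ne_zero (C (q.eval w)⁻¹ * s))
    ((hM.mem_iff _).2 ⟨_, hsdeg, coe_ratL _ _⟩) ?_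
  filter_upwards [coe_ratL hM.eval_ne_zero (C (q.eval w)⁻¹ * s), conjugation_kernelFun hα w,
    ae_pt_ne w] with t h1 h2 h3
  have h4 := hM.eval_ne_zero _ (pt_mem_closedBall t)
  have h5 := hM.eval_ne_zero _ hw
  have h6 := sub_ne_zero.2 h3
  have h7 := congrArg (eval (pt t)) hs
  simp only [hu, eval_sub, eval_mul, eval_C, eval_X] at h7
  rw [h1, h2, bdry, hM.value_eq _ (pt_mem_closedBall t), hM.value_eq w hw, ratFun, eval_mul, eval_C]
  field_simp
  linear_combination -h7

/-- The conjugation is an involution that preserves K_α, so membership carries over from the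
conjugate kernel. -/
theorem IsRationalModel.coe_kernel (hM : IsRationalModel α m q r) (hα : IsInner α)
    {w : ℂ} (hw : w ∈ Metric.closedBall (0 : ℂ) 1) :
    (kernel α w : L2) =ᵐ[arc] kernelFun α w := by
  have h1 := hM.coe_conjKernel hα hw
  have h2 : MemLp (conjugation α (conjKernel α w : L2)) 2 arc := by
    have := ((Lp.memLp (conjKernel α w : L2)).star.mul (p := ⊤) (q := 2) (r := 2)
      ((memLp_star_pt ⊤).mul (p := ⊤) (q := ⊤) (r := ⊤) hα.memLp_bdry))
    exact this
  have h3 := MemLp.coeFn_toLp h2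
  refine coe_toModel (f := h2.toLp _) (conjugation_mem_modelSpace hα (conjKernel α w).2 h3) ?_
  exact h3.trans ((conjugation_congr h1).trans (conjugation_conjugation hα _))

theorem inner_shift_shift (f g : L2) : inner ℂ (shift f) (shift g) = inner ℂ f g := by
  rw [inner_eq_integral, inner_eq_integral]
  refine integral_congr_ae ?_
  filter_upwards [coe_shift f, coe_shift g] with t h1 h2
  rw [h1, h2, star_mul', star_pt]
  have := pt_ne_zero t
  field_simp

theorem inner_one_shift {f : L2} (hf : f ∈ modelSpace α) : inner ℂ one (shift f) = 0 := by
  rw [inner_one, fourierCoeff_shift_zero hf.1]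

/-- Multiplication by `z` inside the model space acts on the pairing with `k_w` as the scalar
`w`. -/
theorem inner_kernel_shift (hα : IsInner α) {w : ℂ}
    (hk : (kernel α w : L2) =ᵐ[arc] kernelFun α w) {f g : modelSpace α}
    (hg : (g : L2) = shift f) : inner ℂ (kernel α w) g = w * inner ℂ (kernel α w) f := by
  -- This is (1 - conj(w) z) k_w = 1 - conj(α(w)) α, valid for boundary w too. The right side is
  -- orthogonal to g: g = zf has mean 0, and g in K_α is orthogonal to α.
  have e : (kernel α w : L2) - star w • shift (kernel α w : L2) =
      one - star (value α w) • hα.bdryL := by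
    refine Lp.ext ?_
    filter_upwards [Lp.coeFn_sub (kernel α w : L2) (star w • shift (kernel α w : L2)),
      Lp.coeFn_smul (star w) (shift (kernel α w : L2)), coe_shift (kernel α w : L2), hk,
      Lp.coeFn_sub one (star (value α w) • hα.bdryL), Lp.coeFn_smul (star (value α w)) hα.bdryL,
      coe_one, hα.coe_bdryL, ae_pt_ne w] with t h1 h2 h3 h4 h5 h6 h7 h8 h9
    have h10 := one_sub_star_mul_pt_ne_zero h9
    rw [h1, h5, Pi.sub_apply, Pi.sub_apply, h2, h6, Pi.smul_apply, Pi.smul_apply, h3, h4, h7, h8,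
      kernelFun, smul_eq_mul, smul_eq_mul]
    field_simp
  have h := congrArg (fun x => inner ℂ x (g : L2)) e
  simp only [inner_sub_left, inner_smul_left, inner_bdryL_modelSpace hα g.2] at h
  rw [hg, inner_shift_shift, inner_one_shift f.2, ← hg] at h
  rw [Submodule.coe_inner, Submodule.coe_inner]
  simpa [sub_eq_zero] using h

/-- The counterpart of `inner_kernel_shift` for the conjugate kernels. -/
theorem inner_conjKernel_shift (hα : IsInner α) {w : ℂ}
    (hk : (conjKernel α w : L2) =ᵐ[arc] conjugation α (kernelFun α w)) {f g : modelSpace α}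
    (hg : (g : L2) = shift f) :
    inner ℂ f (conjKernel α w) = w * inner ℂ g (conjKernel α w) := by
  -- Here (z - w) times the conjugate kernel is α - α(w), again orthogonal to g = zf.
  have e : shift (conjKernel α w : L2) - w • (conjKernel α w : L2) =
      hα.bdryL - value α w • one := by
    refine Lp.ext ?_
    filter_upwards [Lp.coeFn_sub (shift (conjKernel α w : L2)) (w • (conjKernel α w : L2)),
      Lp.coeFn_smul w (conjKernel α w : L2), coe_shift (conjKernel α w : L2), hk,
      Lp.coeFn_sub hα.bdryL (value α w • one), Lp.coeFn_smul (value α w) one,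
      coe_one, hα.coe_bdryL, ae_pt_ne w, conjugation_kernelFun hα w]
      with t h1 h2 h3 h4 h5 h6 h7 h8 h9 h10
    have h11 := sub_ne_zero.2 h9
    rw [h1, h5, Pi.sub_apply, Pi.sub_apply, h2, h6, Pi.smul_apply, Pi.smul_apply, h3, h4, h7, h8,
      h10, smul_eq_mul, smul_eq_mul]
    field_simp
  have h := congrArg (fun x => inner ℂ (g : L2) x) e
  have h0 : inner ℂ (g : L2) hα.bdryL = 0 := by
    rw [← inner_conj_symm, inner_bdryL_modelSpace hα g.2, map_zero]
  have h1 : inner ℂ (g : L2) one = 0 := by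
    rw [← inner_conj_symm, hg, inner_one_shift f.2, map_zero]
  simp only [inner_sub_right, inner_smul_right, h0, h1] at h
  rw [hg, inner_shift_shift, ← hg] at h
  rw [Submodule.coe_inner, Submodule.coe_inner]
  simpa [sub_eq_zero] using h

/-- The functions `z ^ i / q`, `i < m`, in the model space. -/
def IsRationalModel.monomial (hM : IsRationalModel α m q r) (i : Fin m) : modelSpace α :=
  ⟨ratL q hM.eval_ne_zero (X ^ (i : ℕ)), (hM.mem_iff _).2
    ⟨X ^ (i : ℕ), by rw [degree_X_pow]; exact_mod_cast i.2, coe_ratL _ _⟩⟩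

theorem IsRationalModel.coe_monomial (hM : IsRationalModel α m q r) (i : Fin m) :
    (hM.monomial i : L2) =ᵐ[arc] ratFun (X ^ (i : ℕ)) q := coe_ratL _ _

theorem IsRationalModel.monomial_succ (hM : IsRationalModel α m q r) {i : ℕ} (hi : i + 1 < m) :
    (hM.monomial ⟨i + 1, hi⟩ : L2) = shift (hM.monomial ⟨i, by omega⟩ : L2) := by
  refine Lp.ext ?_
  filter_upwards [hM.coe_monomial ⟨i + 1, hi⟩, hM.coe_monomial ⟨i, by omega⟩,
    coe_shift (hM.monomial ⟨i, by omega⟩ : L2)] with t h1 h2 h3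
  rw [h1, h3, h2, ratFun, ratFun, eval_pow, eval_pow, eval_X, pow_succ]
  ring

/-- Linear maps on the model space are determined by their values at the functions `z ^ i / q`. -/
theorem IsRationalModel.linearMap_ext (hM : IsRationalModel α m q r) {V : Type*} [AddCommGroup V]
    [Module ℂ V] {A B : modelSpace α →ₗ[ℂ] V} (h : ∀ i, A (hM.monomial i) = B (hM.monomial i)) :
    A = B := by
  ext f
  obtain ⟨p, hp, he⟩ := (hM.mem_iff f).1 f.2
  have hf : f = ∑ i : Fin m, p.coeff i • hM.monomial i := by
    apply Subtype.ext
    have h1 : (f : L2) = ratL q hM.eval_ne_zero p := Lp.ext (he.trans (coe_ratL _ _).symm)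
    have h2 : p = ∑ i : Fin m, p.coeff i • (X : ℂ[X]) ^ (i : ℕ) := by
      rcases eq_or_ne p 0 with rfl | h0
      · simp
      conv_lhs => rw [p.as_sum_range' m ((natDegree_lt_iff_degree_lt h0).2 hp)]
      rw [← Fin.sum_univ_eq_sum_range (fun i => Polynomial.monomial i (p.coeff i)) m]
      refine Finset.sum_congr rfl fun i _ => ?_
      rw [← C_mul_X_pow_eq_monomial, smul_eq_C_mul]
    rw [h1]
    conv_lhs => rw [h2]
    simp [IsRationalModel.monomial]
  rw [hf, map_sum, map_sum]
  exact Finset.sum_congr rfl fun i _ => by rw [map_smul, map_smul, h]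

theorem IsRationalModel.eq_zero_of_inner (hM : IsRationalModel α m q r) {x : modelSpace α}
    (h : ∀ i, inner ℂ (hM.monomial i) x = 0) : x = 0 := by
  have h1 : (innerₛₗ ℂ x : modelSpace α →ₗ[ℂ] ℂ) = 0 := hM.linearMap_ext fun i => by
    rw [innerₛₗ_apply_apply, ← inner_conj_symm, h i, map_zero, LinearMap.zero_apply]
  rw [← inner_self_eq_zero (𝕜 := ℂ)]
  exact LinearMap.congr_fun h1 x

theorem IsRationalModel.ext_inner (hM : IsRationalModel α m q r) {x y : modelSpace α}
    (h : ∀ i, inner ℂ (hM.monomial i) x = inner ℂ (hM.monomial i) y) : x = y :=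
  sub_eq_zero.1 (hM.eq_zero_of_inner fun i => by rw [inner_sub_right, h i, sub_self])

theorem IsRationalModel.inner_kernel_monomial (hM : IsRationalModel α m q r) (hα : IsInner α)
    (hm : 0 < m) {w : ℂ} (hw : w ∈ Metric.closedBall (0 : ℂ) 1) (i : Fin m) :
    inner ℂ (kernel α w) (hM.monomial i) =
      w ^ (i : ℕ) * inner ℂ (kernel α w) (hM.monomial ⟨0, hm⟩) := by
  obtain ⟨i, hi⟩ := i
  induction i with
  | zero => simp
  | succ i ih =>
    rw [inner_kernel_shift hα (hM.coe_kernel hα hw) (hM.monomial_succ hi), ih (by omega)]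
    ring

theorem IsRationalModel.inner_monomial_conjKernel (hM : IsRationalModel α m q r)
    (hα : IsInner α) (hm : 0 < m) {w : ℂ} (hw : w ∈ Metric.closedBall (0 : ℂ) 1) (i : Fin m) :
    inner ℂ (hM.monomial i) (conjKernel α w) =
      w ^ (m - 1 - i) * inner ℂ (hM.monomial ⟨m - 1, by omega⟩) (conjKernel α w) := by
  obtain ⟨i, hi⟩ := i
  -- Induction downward from the top index m - 1, since each step expresses the pairing at i through
  -- the one at i + 1.
  obtain ⟨k, hk⟩ : ∃ k, k = m - 1 - i := ⟨_, rfl⟩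
  induction k generalizing i with
  | zero =>
    obtain rfl : i = m - 1 := by omega
    simp
  | succ k ih =>
    rw [inner_conjKernel_shift hα (hM.coe_conjKernel hα hw)
      (hM.monomial_succ (i := i) (by omega)), ih (i + 1) (by omega) (by omega)]
    rw [← mul_assoc, ← pow_succ']
    congr 2
    dsimp only
    omega

/-- The model space is trivial if the boundary function of `α` is constant. -/
theorem modelSpace_eq_bot_of_bdry_const (hα : IsInner α) {c : ℂ}
    (hc : bdry α =ᵐ[arc] fun _ => c) : modelSpace α = ⊥ := by
  refine (Submodule.eq_bot_iff _).2 fun f hf => ?_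
  have hf' := (mem_modelSpace_iff hα).1 hf
  have e : hα.mul f = c • f := by
    refine Lp.ext ?_
    filter_upwards [hα.coe_mul f, hc, Lp.coeFn_smul c f] with t h1 h2 h3
    rw [h1, h2, h3, Pi.smul_apply, smul_eq_mul]
  have hc0 : c ≠ 0 := by
    rintro rfl
    obtain ⟨t, h1, h2⟩ := (hc.and hα.norm_bdry).exists
    rw [h1] at h2
    simp at h2
  -- With α constant, αf is itself a multiple of f, so f is orthogonal to itself.
  have h := hf'.2 f hf'.1
  rw [e, inner_smul_left] at h
  simpa [hc0] using h

/-- A vanishing k_w means conj(α(w)) α = 1 almost everywhere, so α is constant on the circle. -/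
theorem kernel_ne_zero (hα : IsInner α) (hne : modelSpace α ≠ ⊥) {w : ℂ}
    (hk : (kernel α w : L2) =ᵐ[arc] kernelFun α w) : kernel α w ≠ 0 := by
  intro h0
  have h1 : kernelFun α w =ᵐ[arc] 0 := by
    rw [h0] at hk
    exact hk.symm.trans (Lp.coeFn_zero ℂ 2 arc)
  refine hne (modelSpace_eq_bot_of_bdry_const hα (c := (star (value α w))⁻¹) ?_)
  filter_upwards [h1, ae_pt_ne w] with t h2 h3
  rw [kernelFun, Pi.zero_apply, div_eq_zero_iff, or_iff_left (one_sub_star_mul_pt_ne_zero h3),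
    sub_eq_zero] at h2
  exact eq_inv_of_mul_eq_one_right h2.symm

theorem conjKernel_ne_zero (hα : IsInner α) (hne : modelSpace α ≠ ⊥) {w : ℂ}
    (hk : (kernel α w : L2) =ᵐ[arc] kernelFun α w)
    (hk' : (conjKernel α w : L2) =ᵐ[arc] conjugation α (kernelFun α w)) :
    conjKernel α w ≠ 0 := by
  intro h0
  refine kernel_ne_zero hα hne hk (Subtype.ext (Lp.ext ?_))
  have h1 : conjugation α (kernelFun α w) =ᵐ[arc] 0 := by
    rw [h0] at hk'
    exact hk'.symm.trans (Lp.coeFn_zero ℂ 2 arc)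
  filter_upwards [hk, h1, conjugation_conjugation hα (kernelFun α w),
    Lp.coeFn_zero ℂ 2 arc] with t h2 h3 h4 h5
  rw [h2, ← h4, conjugation, h3]
  simp

/-- All pairings are multiples of this one, so its vanishing would make k_w orthogonal to a spanning
family. -/
theorem IsRationalModel.inner_kernel_monomial_ne_zero (hM : IsRationalModel α m q r)
    (hα : IsInner α) (hm : 0 < m) (hne : modelSpace α ≠ ⊥) {w : ℂ}
    (hw : w ∈ Metric.closedBall (0 : ℂ) 1) :
    inner ℂ (kernel α w) (hM.monomial ⟨0, hm⟩) ≠ 0 := by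
  intro h0
  refine kernel_ne_zero hα hne (hM.coe_kernel hα hw) (hM.eq_zero_of_inner fun i => ?_)
  refine (inner_eq_zero_symm (𝕜 := ℂ) (E := modelSpace α)).1 ?_
  rw [hM.inner_kernel_monomial hα hm hw, h0, mul_zero]

theorem IsRationalModel.inner_monomial_conjKernel_ne_zero (hM : IsRationalModel α m q r)
    (hα : IsInner α) (hm : 0 < m) (hne : modelSpace α ≠ ⊥) {w : ℂ}
    (hw : w ∈ Metric.closedBall (0 : ℂ) 1) :
    inner ℂ (hM.monomial ⟨m - 1, by omega⟩) (conjKernel α w) ≠ 0 := by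
  intro h0
  refine conjKernel_ne_zero hα hne (hM.coe_kernel hα hw) (hM.coe_conjKernel hα hw)
    (hM.eq_zero_of_inner fun i => ?_)
  rw [hM.inner_monomial_conjKernel hα hm hw, h0, mul_zero]

end Model

/-! ### Toeplitz operators between finite-dimensional model spaces -/

section Toeplitz

open Polynomial

variable {β : ℂ → ℂ} {m n : ℕ} {q₁ r₁ q₂ r₂ : ℂ[X]}

/-- The index of the diagonal of an `n × m` matrix through the entry in column `i` and row `j`. -/
def diagIdx (i : Fin m) (j : Fin n) : Fin (m + n - 1) := ⟨i + (n - 1 - j), by omega⟩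

/-- Every diagonal meets the last row or the last column, so no diagonal value is invisible in the
matrix. -/
theorem exists_diagIdx_eq (hm : 0 < m) (hn : 0 < n) (k : Fin (m + n - 1)) :
    ∃ (i : Fin m) (j : Fin n), diagIdx i j = k := by
  rcases lt_or_ge (k : ℕ) m with h | h
  · exact ⟨⟨k, h⟩, ⟨n - 1, by omega⟩, Fin.ext (by simp [diagIdx])⟩
  · exact ⟨⟨m - 1, by omega⟩, ⟨m - 1 + (n - 1) - k, by omega⟩, Fin.ext (by simp [diagIdx]; omega)⟩

theorem integral_pt_zpow (k : ℤ) : ∫ t, pt t ^ k ∂arc = if k = 0 then 1 else 0 := by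
  have h := fourierCoeff_one (-k)
  rw [fourierCoeff_eq_integral] at h
  have e : ∫ t, pt t ^ (- -k) * one t ∂arc = ∫ t, pt t ^ k ∂arc := by
    refine integral_congr_ae ?_
    filter_upwards [coe_one] with t ht
    rw [ht, mul_one, neg_neg]
  rw [← e, h]
  simp

theorem memLp_monomial (hα : IsRationalModel α m q₁ r₁) (i : Fin m) :
    MemLp ((hα.monomial i : L2) : Torus → ℂ) ⊤ arc :=
  (memLp_congr_ae (hα.coe_monomial i)).2
    (memLp_of_continuous (continuous_ratFun hα.eval_ne_zero _) ⊤)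

theorem inner_proj (g : modelSpace β) (x : L2) : inner ℂ g (proj β x) = inner ℂ (g : L2) x := by
  rw [Submodule.coe_inner]
  exact Submodule.inner_orthogonalProjectionOnto_eq_of_mem_left g x

/-- The matrix of an operator in `𝒯(α, β)` with respect to the functions `z ^ i / q` is constant
along diagonals. -/
theorem exists_entries_of_mem_toeplitz (hα : IsRationalModel α m q₁ r₁)
    (hβ : IsRationalModel β n q₂ r₂) {A : modelSpace α →L[ℂ] modelSpace β}
    (hA : A ∈ toeplitz α β) : ∃ τ : Fin (m + n - 1) → ℂ, ∀ i j,
      inner ℂ (hβ.monomial j) (A (hα.monomial i)) = τ (diagIdx i j) := by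
  obtain ⟨φ, hφ⟩ := hA
  refine ⟨fun k => ∫ t, φ t * pt t ^ ((k : ℤ) - (n - 1)) /
    (q₁.eval (pt t) * star (q₂.eval (pt t))) ∂arc, fun i j => ?_⟩
  obtain ⟨h, e⟩ := hφ _ (memLp_monomial hα i)
  rw [e, inner_proj, inner_eq_integral]
  refine integral_congr_ae ?_
  filter_upwards [h.coeFn_toLp, hα.coe_monomial i, hβ.coe_monomial j] with t h1 h2 h3
  have hexp : ((diagIdx i j : ℕ) : ℤ) - (n - 1) = (i : ℕ) + -((j : ℕ) : ℤ) := by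
    simp only [diagIdx]; omega
  rw [h1, h2, h3, ratFun, ratFun, star_div₀, hexp, zpow_add₀ (pt_ne_zero t), zpow_natCast,
    zpow_neg, zpow_natCast, eval_pow, eval_pow, eval_X, star_pow, star_pt, inv_pow]
  ring

theorem mem_toeplitz_of_entries (hα : IsRationalModel α m q₁ r₁)
    (hβ : IsRationalModel β n q₂ r₂) {A : modelSpace α →L[ℂ] modelSpace β}
    {τ : Fin (m + n - 1) → ℂ} (h : ∀ i j,
      inner ℂ (hβ.monomial j) (A (hα.monomial i)) = τ (diagIdx i j)) : A ∈ toeplitz α β := by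
  -- The factor q₁ conj(q₂) cancels both denominators. As i - j is the diagonal index minus n - 1,
  -- the k-th term contributes z to the power (diagonal index - k), and the mean keeps only τ at
  -- that diagonal.
  set b : Torus → ℂ := fun t => q₁.eval (pt t) * star (q₂.eval (pt t)) *
    ∑ k : Fin (m + n - 1), τ k * pt t ^ ((n : ℤ) - 1 - k) with hb
  have hbc : Continuous b := by
    refine ((q₁.continuous.comp continuous_pt).mul
      (continuous_star.comp (q₂.continuous.comp continuous_pt))).mul ?_
    exact continuous_finsetSum _ fun k _ => continuous_const.mul
      (continuous_pt.zpow₀ _ fun t => Or.inl (pt_ne_zero t))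
  have hbL := memLp_of_continuous hbc ⊤
  have hb2 := memLp_of_continuous hbc 2
  have hAM : (A : modelSpace α →ₗ[ℂ] modelSpace β) =
      (proj β : L2 →ₗ[ℂ] modelSpace β) ∘ₗ mulOp b hbL ∘ₗ (modelSpace α).subtype := by
    refine hα.linearMap_ext fun i => hβ.ext_inner fun j => ?_
    rw [ContinuousLinearMap.coe_coe, h i j]
    simp only [LinearMap.comp_apply, ContinuousLinearMap.coe_coe, Submodule.subtype_apply]
    rw [inner_proj, inner_eq_integral]
    have e : ∫ t, (mulOp b hbL (hα.monomial i : L2) : L2) t *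
        star ((hβ.monomial j : L2) t) ∂arc =
        ∫ t, ∑ k : Fin (m + n - 1), τ k * pt t ^ ((diagIdx i j : ℕ) - (k : ℕ) : ℤ) ∂arc := by
      refine integral_congr_ae ?_
      filter_upwards [coe_mulOp b hbL (hα.monomial i : L2), hα.coe_monomial i,
        hβ.coe_monomial j] with t h1 h2 h3
      have h4 := hα.eval_ne_zero _ (pt_mem_closedBall t)
      have h5 := star_ne_zero.2 (hβ.eval_ne_zero _ (pt_mem_closedBall t))
      have h6 (k : Fin (m + n - 1)) : pt t ^ ((diagIdx i j : ℕ) - (k : ℕ) : ℤ) =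
          pt t ^ ((n : ℤ) - 1 - k) * (pt t ^ (i : ℕ) * (pt t ^ (j : ℕ))⁻¹) := by
        have hexp : ((diagIdx i j : ℕ) - (k : ℕ) : ℤ) =
            ((n : ℤ) - 1 - k) + ((i : ℕ) + -((j : ℕ) : ℤ)) := by
          simp only [diagIdx]; omega
        rw [hexp, zpow_add₀ (pt_ne_zero t), zpow_add₀ (pt_ne_zero t), zpow_natCast,
          zpow_neg, zpow_natCast]
      simp only [h6, ← mul_assoc]
      rw [h1, h2, h3, hb, ratFun, ratFun, star_div₀, eval_pow, eval_pow, eval_X, star_pow,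
        star_pt, inv_pow, ← Finset.sum_mul, ← Finset.sum_mul]
      field_simp
    have hint (k : Fin (m + n - 1)) :
        Integrable (fun t => τ k * pt t ^ ((diagIdx i j : ℕ) - (k : ℕ) : ℤ)) arc :=
      (memLp_of_continuous (continuous_const.mul
        (continuous_pt.zpow₀ _ fun t => Or.inl (pt_ne_zero t))) 1).integrable le_rfl
    refine Eq.trans ?_ e.symm
    rw [integral_finsetSum _ fun k _ => hint k]
    simp only [integral_const_mul, integral_pt_zpow]
    rw [Finset.sum_eq_single (diagIdx i j)]
    · simp
    · intro k _ hk
      rw [if_neg, mul_zero]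
      intro h0
      exact hk (Fin.ext (by omega))
    · simp
  refine ⟨hb2.toLp b, fun f _ => ?_⟩
  have e : (fun t => (hb2.toLp b : L2) t * (f : L2) t) =ᵐ[arc] mulOp b hbL (f : L2) := by
    filter_upwards [hb2.coeFn_toLp, coe_mulOp b hbL (f : L2)] with t h1 h2
    rw [h1, h2]
  have hmem : MemLp (fun t => (hb2.toLp b : L2) t * (f : L2) t) 2 arc :=
    (memLp_congr_ae e).2 (Lp.memLp _)
  refine ⟨hmem, ?_⟩
  have h1 : hmem.toLp _ = mulOp b hbL (f : L2) := Lp.ext (hmem.coeFn_toLp.trans e)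
  rw [h1]
  exact LinearMap.congr_fun hAM f

/-- Operators whose matrices are constant along diagonals form a basis of `𝒯(α, β)` as soon as the
vectors of their diagonal entries are linearly independent and as many as there are diagonals. -/
theorem exists_basis_of_entries (hα : IsRationalModel α m q₁ r₁) (hβ : IsRationalModel β n q₂ r₂)
    (hm : 0 < m) (hn : 0 < n) {A : Fin (m + n - 1) → modelSpace α →L[ℂ] modelSpace β}
    {τ : Fin (m + n - 1) → Fin (m + n - 1) → ℂ} (hτ : LinearIndependent ℂ τ)
    (h : ∀ l i j, inner ℂ (hβ.monomial j) (A l (hα.monomial i)) = τ l (diagIdx i j)) :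
    ∃ b : Module.Basis (Fin (m + n - 1)) ℂ (toeplitz α β), ∀ l,
      (b l : modelSpace α →L[ℂ] modelSpace β) = A l := by
  have hsum (x : Fin (m + n - 1) → ℂ) (i : Fin m) (j : Fin n) :
      inner ℂ (hβ.monomial j) ((∑ l, x l • A l) (hα.monomial i)) =
        (∑ l, x l • τ l) (diagIdx i j) := by
    simp [sum_apply, h]
  let a : Fin (m + n - 1) → toeplitz α β := fun l => ⟨A l, mem_toeplitz_of_entries hα hβ (h l)⟩
  have ha (x : Fin (m + n - 1) → ℂ) : ((∑ l, x l • a l : toeplitz α β) :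
      modelSpace α →L[ℂ] modelSpace β) = ∑ l, x l • A l := by
    rw [AddSubmonoidClass.coe_finsetSum]; rfl
  have hli : LinearIndependent ℂ a := by
    refine LinearIndependent.of_comp (toeplitz α β).subtype ?_
    refine Fintype.linearIndependent_iff.2 fun x hx => ?_
    refine Fintype.linearIndependent_iff.1 hτ x (funext fun k => ?_)
    obtain ⟨i, j, rfl⟩ := exists_diagIdx_eq hm hn k
    replace hx : ∑ l, x l • A l = 0 := hx
    rw [← hsum, hx]
    simp
  have hspan : ⊤ ≤ Submodule.span ℂ (Set.range a) := by
    rintro B -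
    obtain ⟨σ, hσ⟩ := exists_entries_of_mem_toeplitz hα hβ B.2
    -- As many independent vectors as there are diagonals span all diagonal vectors, in particular
    -- that of `B`.
    have htop := hτ.span_eq_top_of_card_eq_finrank' (by simp)
    obtain ⟨x, hx⟩ := (Submodule.mem_span_range_iff_exists_fun ℂ).1
      (htop ▸ Submodule.mem_top : σ ∈ Submodule.span ℂ (Set.range τ))
    refine (Submodule.mem_span_range_iff_exists_fun ℂ).2 ⟨x, Subtype.ext ?_⟩
    rw [ha]
    refine ContinuousLinearMap.coe_injective
      (hα.linearMap_ext fun i => hβ.ext_inner fun j => ?_)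
    rw [ContinuousLinearMap.coe_coe, ContinuousLinearMap.coe_coe, hsum, hx, hσ]
  exact ⟨Module.Basis.mk hli hspan, fun l => by rw [Module.Basis.mk_apply]⟩

/-- The rows of a Vandermonde matrix with distinct nodes, rescaled by nonzero factors. -/
theorem linearIndependent_geometric {N : ℕ} {w c : Fin N → ℂ} (hw : Function.Injective w)
    (hc : ∀ l, c l ≠ 0) : LinearIndependent ℂ fun l (k : Fin N) => c l * w l ^ (k : ℕ) := by
  have h := Matrix.linearIndependent_rows_of_det_ne_zero (Matrix.det_vandermonde_ne_zero_iff.2 hw)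
  exact h.units_smul fun l => Units.mk0 (c l) (hc l)

theorem linearIndependent_geometric_rev {N : ℕ} {w c : Fin N → ℂ} (hw : Function.Injective w)
    (hc : ∀ l, c l ≠ 0) :
    LinearIndependent ℂ fun l (k : Fin N) => c l * w l ^ (k.rev : ℕ) := by
  refine Fintype.linearIndependent_iff.2 fun x hx => ?_
  refine Fintype.linearIndependent_iff.1 (linearIndependent_geometric hw hc) x (funext fun k => ?_)
  have h := congrFun hx k.rev
  simpa only [Finset.sum_apply, Pi.smul_apply, Fin.rev_rev, Pi.zero_apply] using h

theorem inner_tensor (g x : modelSpace β) (h f : modelSpace α) :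
    inner ℂ x (tensor g h f) = inner ℂ h f * inner ℂ x g := by
  rw [tensor, InnerProductSpace.rankOne_apply, inner_smul_right]

end Toeplitz

end ATTO

end

theorem corollary2p3 (α β : ℂ → ℂ) (hα : ATTO.IsInner α) (hβ : ATTO.IsInner β)
    [FiniteDimensional ℂ (ATTO.modelSpace α)] [FiniteDimensional ℂ (ATTO.modelSpace β)]
    (m n : ℕ) (hm : 0 < m) (hn : 0 < n)
    (hαm : Module.finrank ℂ (ATTO.modelSpace α) = m)
    (hβn : Module.finrank ℂ (ATTO.modelSpace β) = n)
    (w : Fin (m + n - 1) → ℂ) (hw : Function.Injective w)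
    (hw1 : ∀ j, w j ∈ Metric.closedBall (0 : ℂ) 1) :
    (∀ j, (ATTO.kernel α (w j) : ATTO.L2) =ᵐ[ATTO.arc] ATTO.kernelFun α (w j) ∧
      (ATTO.conjKernel α (w j) : ATTO.L2) =ᵐ[ATTO.arc]
        ATTO.conjugation α (ATTO.kernelFun α (w j)) ∧
      (ATTO.kernel β (w j) : ATTO.L2) =ᵐ[ATTO.arc] ATTO.kernelFun β (w j) ∧
      (ATTO.conjKernel β (w j) : ATTO.L2) =ᵐ[ATTO.arc]
        ATTO.conjugation β (ATTO.kernelFun β (w j))) ∧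
    (∃ b : Module.Basis (Fin (m + n - 1)) ℂ (ATTO.toeplitz α β),
      ∀ j, (b j : ATTO.modelSpace α →L[ℂ] ATTO.modelSpace β) =
        ATTO.tensor (ATTO.conjKernel β (w j)) (ATTO.kernel α (w j))) ∧
    (∃ b : Module.Basis (Fin (m + n - 1)) ℂ (ATTO.toeplitz α β),
      ∀ j, (b j : ATTO.modelSpace α →L[ℂ] ATTO.modelSpace β) =
        ATTO.tensor (ATTO.kernel β (w j)) (ATTO.conjKernel α (w j))) := by
  obtain ⟨q₁, r₁, hM₁⟩ := ATTO.exists_isRationalModel hα hαm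
  obtain ⟨q₂, r₂, hM₂⟩ := ATTO.exists_isRationalModel hβ hβn
  have hne₁ : ATTO.modelSpace α ≠ ⊥ := fun h => by
    rw [h, finrank_bot] at hαm; omega
  have hne₂ : ATTO.modelSpace β ≠ ⊥ := fun h => by
    rw [h, finrank_bot] at hβn; omega
  refine ⟨fun j => ⟨hM₁.coe_kernel hα (hw1 j), hM₁.coe_conjKernel hα (hw1 j),
    hM₂.coe_kernel hβ (hw1 j), hM₂.coe_conjKernel hβ (hw1 j)⟩, ?_, ?_⟩
  -- The entry is w^i · w^(n-1-j) times the two extreme pairings, and i + (n-1-j) is exactly the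
  -- diagonal index.
  · refine ATTO.exists_basis_of_entries hM₁ hM₂ hm hn
      (ATTO.linearIndependent_geometric (c := fun l =>
        inner ℂ (ATTO.kernel α (w l)) (hM₁.monomial ⟨0, hm⟩) *
          inner ℂ (hM₂.monomial ⟨n - 1, by omega⟩) (ATTO.conjKernel β (w l))) hw fun l =>
        mul_ne_zero (hM₁.inner_kernel_monomial_ne_zero hα hm hne₁ (hw1 l))
          (hM₂.inner_monomial_conjKernel_ne_zero hβ hn hne₂ (hw1 l))) fun l i j => ?_
    rw [ATTO.inner_tensor, hM₁.inner_kernel_monomial hα hm (hw1 l),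
      hM₂.inner_monomial_conjKernel hβ hn (hw1 l), ATTO.diagIdx, pow_add]
    ring
  -- Swapping the roles of the kernels conjugates both pairings, so the ratio is conj w. The
  -- exponent (m-1-i) + j is the diagonal index counted from the other end.
  · refine ATTO.exists_basis_of_entries hM₁ hM₂ hm hn
      (ATTO.linearIndependent_geometric_rev (w := fun l => star (w l)) (c := fun l =>
        star (inner ℂ (hM₁.monomial ⟨m - 1, by omega⟩) (ATTO.conjKernel α (w l))) *
          star (inner ℂ (ATTO.kernel β (w l)) (hM₂.monomial ⟨0, hn⟩)))
        (star_injective.comp hw) fun l =>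
        mul_ne_zero
          (star_ne_zero.2 (hM₁.inner_monomial_conjKernel_ne_zero hα hm hne₁ (hw1 l)))
          (star_ne_zero.2 (hM₂.inner_kernel_monomial_ne_zero hβ hn hne₂ (hw1 l)))) fun l i j => ?_
    have hexp : ((ATTO.diagIdx i j).rev : ℕ) = (m - 1 - i) + j := by
      rw [Fin.val_rev]; simp only [ATTO.diagIdx]; omega
    rw [ATTO.inner_tensor, ← inner_conj_symm (ATTO.conjKernel α (w l)),
      ← inner_conj_symm _ (ATTO.kernel β (w l)), hM₁.inner_monomial_conjKernel hα hm (hw1 l),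
      hM₂.inner_kernel_monomial hβ hn (hw1 l), hexp, pow_add, map_mul, map_mul, map_pow, map_pow]
    simp only [← Complex.star_def]
    ring
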